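/- Let $N\ge 2$ be an integer and $E^+>0$. There is a constant $C>0$, depending only on $N$ and $E^+$, such that the following holds. Let $\mathcal H$ be a complex Hilbert space (of arbitrary dimension), $\rho$ a density operator on $\mathcal H$ (positive, $\operatorname{tr}\rho=1$), $H$ a self-adjoint operator on $\mathcal H$ with $\operatorname{spec}(H)\subseteq[0,E^+]$, and $(M_0,M_1)$ a two-outcome POVM on $\mathcal H$ (that is, $M_0,M_1\ge 0$ and $M_0+M_1=\mathbb I$). Put $$P(a|t)=\operatorname{tr}\!\left(e^{-iHt}\rho\, e^{iHt}M_a\right),\qquad t_j=\frac{2\pi(N-1)j}{N E^+},\quad j=0,\dots,N-1,$$ and let $\mathbf D_N$ be the dataset with $\mathbf D_N(0|t_0)=1$, $\mathbf D_N(0|t_j)=0$ for $j=1,\dots,N-1$, and $\mathbf D_N(1|t_j)=1-\mathbf D_N(0|t_j)$. Suppose that, for some real number $\delta$, $$\sum_{a\in\{0,1\}}\left|P(a|t_j)-\mathbf D_N(a|t_j)\right|\le\delta\qquad\text{for } j=0,\dots,N-1 .$$ On $\mathbb C^N$ with standard basis $|0\rangle,\dots,|N-1\rangle$ define $$\bar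 H=\frac{E^+}{N-1}\sum_{k=0}^{N-1}k\,|k\rangle\langle k|,\quad |\bar\psi\rangle=\frac1{\sqrt N}\sum_{k=0}^{N-1}|k\rangle,\quad \bar M_0=|\bar\psi\rangle\langle\bar\psi|,\quad \bar M_1=\mathbb I-|\bar\psi\rangle\langle\bar\psi| .$$ Then there exist a Hilbert space $K$, a linear isometry $V:\mathcal H\to\mathbb C^N\otimes K$ and a density operator $\gamma$ on $K$ such that, for all $t\in\mathbb R$ and $a\in\{0,1\}$, $$\left\|V M_a e^{-iHt}\rho\, e^{iHt}V^\dagger-\left(\bar M_a e^{-i\bar Ht}|\bar\psi\rangle\langle\bar\psi|e^{i\bar Ht}\right)\otimes\gamma\right\|_1\le C\,\delta^{1/64}+C\,\delta^{1/8}|t| ,$$ where $\|X\|_1=\operatorname{tr}\sqrt{X^\dagger X}$ is the trace norm. -/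

import Mathlib

universe u v

open scoped TensorProduct InnerProductSpace

noncomputable section

namespace SelfTest

/-! ### Trace and trace norm of operators on a Hilbert space -/

section Operators

variable (E : Type u) [NormedAddCommGroup E] [InnerProductSpace ℂ E] [CompleteSpace E]

/-- Index set of a fixed orthonormal (Hilbert) basis of `E`. -/
def basisIndex : Set E := (exists_hilbertBasis ℂ E).choose

/-- A fixed orthonormal (Hilbert) basis of `E`. The trace of a trace-class operator and the trace
norm of any operator do not depend on this choice. -/
def onb : HilbertBasis (basisIndex E) ℂ E := (exists_hilbertBasis ℂ E).choose_spec.choose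

variable {E}

/-- The trace `∑ᵢ ⟨eᵢ, T eᵢ⟩`; meaningful for trace-class `T`. -/
def trace (T : E →L[ℂ] E) : ℂ := ∑' i, ⟪onb E i, T (onb E i)⟫_ℂ

/-- The trace norm `‖T‖₁ = tr |T|` with `|T| = √(T† T)`; it is `∞` iff `T` is not trace class. -/
def traceNorm (T : E →L[ℂ] E) : ENNReal :=
  ∑' i, ENNReal.ofReal (⟪onb E i, CFC.abs T (onb E i)⟫_ℂ).re

/-- Normalized quantum states: positive operators of trace one. (If the defining series of the trace
did not converge, `trace ρ` would be `0`; so the second condition includes convergence.) -/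
def IsDensityOperator (ρ : E →L[ℂ] E) : Prop := ρ.IsPositive ∧ trace ρ = 1

/-- Schrödinger evolution `e^{-iHt} ρ e^{iHt}`. -/
def evolve (H ρ : E →L[ℂ] E) (t : ℝ) : E →L[ℂ] E :=
  NormedSpace.exp ((-(Complex.I * (t : ℂ))) • H) * ρ * NormedSpace.exp ((Complex.I * (t : ℂ)) • H)

/-- The projector `|ψ⟩⟨ψ|` (for a unit vector `ψ`). -/
def proj (ψ : E) : E →L[ℂ] E := InnerProductSpace.rankOne ℂ ψ ψ

end Operators

/-! ### Realizations of timelines -/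

/-- A realization `(𝓗, ρ, H, M)` of a timeline of a single measurement with outcomes in `A`.
The Hamiltonian is bounded, since only Hamiltonians with spectrum in `[0, E⁺]` are considered. -/
structure Realization (𝓗 : Type u) [NormedAddCommGroup 𝓗] [InnerProductSpace ℂ 𝓗]
    [CompleteSpace 𝓗] (A : Type v) [Fintype A] where
  /-- the initial state -/
  state : 𝓗 →L[ℂ] 𝓗
  /-- the Hamiltonian -/
  hamiltonian : 𝓗 →L[ℂ] 𝓗
  /-- the POVM elements -/
  meas : A → (𝓗 →L[ℂ] 𝓗)
  isDensityOperator_state : IsDensityOperator state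
  isSelfAdjoint_hamiltonian : IsSelfAdjoint hamiltonian
  isPositive_meas : ∀ a, (meas a).IsPositive
  sum_meas : ∑ a, meas a = 1

namespace Realization

variable {𝓗 : Type u} [NormedAddCommGroup 𝓗] [InnerProductSpace ℂ 𝓗] [CompleteSpace 𝓗]
  {A : Type v} [Fintype A]

/-- The timeline `P(a|t) = tr(e^{-iHt} ρ e^{iHt} M_a)` (which is a real number). -/
def timeline (R : Realization 𝓗 A) (a : A) (t : ℝ) : ℝ :=
  (trace (evolve R.hamiltonian R.state t * R.meas a)).re

/-- The hard support constraint `spec(H) ⊆ [0, E⁺]`. -/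
def HardSupport (R : Realization 𝓗 A) (Eplus : ℝ) : Prop :=
  spectrum ℝ R.hamiltonian ⊆ Set.Icc 0 Eplus

end Realization

/-! ### The dataset `D_N` -/

/-- The times `t_j = 2π(N-1)j / (N E⁺)`. -/
def dataTime (N : ℕ) (Eplus : ℝ) (j : Fin N) : ℝ :=
  2 * Real.pi * ((N : ℝ) - 1) * ((j : ℕ) : ℝ) / ((N : ℝ) * Eplus)

/-- The dataset `D_N`: at `t_0` the first outcome (here `0`) is certain; at `t_1, …, t_{N-1}` the
second outcome (here `1`) is certain. -/
def dataset (N : ℕ) (a : Fin 2) (j : Fin N) : ℝ :=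
  if (j : ℕ) = 0 then (if a = 0 then 1 else 0) else (if a = 0 then 0 else 1)

/-- The timeline `P` fits `D_N` up to error `δ`. -/
def Fits (N : ℕ) (Eplus δ : ℝ) (P : Fin 2 → ℝ → ℝ) : Prop :=
  ∀ j : Fin N, ∑ a, |P a (dataTime N Eplus j) - dataset N a j| ≤ δ

/-! ### The reference realization on `ℂ^N` -/

/-- `H̄ = E⁺/(N-1) ∑ₖ k |k⟩⟨k|`. -/
def refHamiltonian (N : ℕ) (Eplus : ℝ) : EuclideanSpace ℂ (Fin N) →L[ℂ] EuclideanSpace ℂ (Fin N) :=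
  ((Eplus / ((N : ℝ) - 1) : ℝ) : ℂ) •
    ∑ k : Fin N, ((k : ℕ) : ℂ) • proj (EuclideanSpace.single k (1 : ℂ))

/-- `|ψ̄⟩ = N^{-1/2} ∑ₖ |k⟩`. -/
def refVector (N : ℕ) : EuclideanSpace ℂ (Fin N) :=
  (((Real.sqrt N)⁻¹ : ℝ) : ℂ) • ∑ k : Fin N, EuclideanSpace.single k (1 : ℂ)

/-- The projective measurement `(|ψ̄⟩⟨ψ̄|, 𝟙 - |ψ̄⟩⟨ψ̄|)`. -/
def refMeas (N : ℕ) : Fin 2 → (EuclideanSpace ℂ (Fin N) →L[ℂ] EuclideanSpace ℂ (Fin N)) :=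
  ![proj (refVector N), 1 - proj (refVector N)]

/-! ### The Hilbert space `ℂ^N ⊗ K` -/

section Tensor

variable (N : ℕ) (K : Type u) [NormedAddCommGroup K] [InnerProductSpace ℂ K]

/-- The map `K^N → ℂ^N ⊗ K`, `x ↦ ∑ₖ |k⟩ ⊗ xₖ`. -/
def sumTmul : PiLp 2 (fun _ : Fin N => K) →ₗ[ℂ] EuclideanSpace ℂ (Fin N) ⊗[ℂ] K where
  toFun x := ∑ k, EuclideanSpace.single k (1 : ℂ) ⊗ₜ[ℂ] x k
  map_add' x y := by simp [TensorProduct.tmul_add, Finset.sum_add_distrib]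
  map_smul' c x := by simp [Finset.smul_sum]

theorem inner_sumTmul (x y : PiLp 2 (fun _ : Fin N => K)) :
    ⟪sumTmul N K x, sumTmul N K y⟫_ℂ = ⟪x, y⟫_ℂ := by
  simp [sumTmul, sum_inner, inner_sum, PiLp.inner_apply]

theorem sumTmul_surjective : Function.Surjective (sumTmul N K) := by
  intro z
  induction z using TensorProduct.induction_on with
  | zero => exact ⟨0, map_zero _⟩
  | tmul v w =>
    refine ⟨WithLp.toLp 2 (fun k => v k • w), ?_⟩
    have h : v = ∑ k, v k • EuclideanSpace.single k (1 : ℂ) := by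
      ext j
      simp [Pi.single_apply]
    conv_rhs => rw [h, TensorProduct.sum_tmul]
    simp [sumTmul, TensorProduct.smul_tmul]
  | add a b ha hb =>
    obtain ⟨x, rfl⟩ := ha
    obtain ⟨y, rfl⟩ := hb
    exact ⟨x + y, map_add _ _ _⟩

/-- Since `ℂ^N` is finite-dimensional, the algebraic tensor product is already complete. -/
instance instCompleteSpaceTensor [CompleteSpace K] :
    CompleteSpace (EuclideanSpace ℂ (Fin N) ⊗[ℂ] K) := by
  let e : PiLp 2 (fun _ : Fin N => K) ≃ₗᵢ[ℂ] EuclideanSpace ℂ (Fin N) ⊗[ℂ] K :=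
    LinearIsometryEquiv.ofSurjective
      ((sumTmul N K).isometryOfInner (inner_sumTmul N K)) (sumTmul_surjective N K)
  exact (completeSpace_congr (e := e.toEquiv) e.isometry.isUniformEmbedding).1 inferInstance

end Tensor

/-- `V X V†` for an isometry `V`. -/
def conjIsometry {E : Type u} {F : Type v} [NormedAddCommGroup E] [InnerProductSpace ℂ E]
    [CompleteSpace E] [NormedAddCommGroup F] [InnerProductSpace ℂ F] [CompleteSpace F]
    (V : E →ₗᵢ[ℂ] F) (X : E →L[ℂ] E) : F →L[ℂ] F :=
  V.toContinuousLinearMap ∘L X ∘L ContinuousLinearMap.adjoint V.toContinuousLinearMap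

end SelfTest

end

set_option linter.unusedSectionVars false

noncomputable section

namespace SelfTest

open ContinuousLinearMap

/-! ### Hilbert–Schmidt sums and the trace norm -/

section HilbertSchmidt

variable {E F G : Type*} [NormedAddCommGroup E] [InnerProductSpace ℂ E] [CompleteSpace E]
  [NormedAddCommGroup F] [InnerProductSpace ℂ F] [CompleteSpace F]
  [NormedAddCommGroup G] [InnerProductSpace ℂ G] [CompleteSpace G]

/-! Write `Ψ = √ρ` and let `w` be the square-summable family `(Ψ eᵢ)`, a unit vector purifying the
state. An operator `X` acts on it entrywise (`amp w X`), and `‖amp w X‖` is the Hilbert–Schmidt norm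
of `XΨ`. Everything is estimated on this one vector; below, `X w` means `amp w X`.

Let `U = e^{-iHτ}` with `τ` the spacing of the data times. The data say that `M₁ w` and `M₀ U^j w`,
`0 < j < N`, have norm at most `η = √δ`, so `⟨w, U^j w⟩` is `O(η)`. The spectral bound turns this
into `U^N w ≈ w`: the phases `τx` fill only an arc of length `2π - 2π/N`, and on that arc a
trigonometric polynomial of degree below `N` without constant term dominates `|e^{-iNτx} - 1|²`
(`one_add_cos_le_neg_sineKernel`). Taking expectations gives `‖(U^N - 1) w‖² = O(η)`
(`norm_amp_propagator_sub_one_sq_le`). This is where `ζ = O(δ^{1/4})` arises.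

Consequently the Fourier components `P_k` of `U` behave on `w` like the spectral projections of `U`.
Since the arc does not close up, closeness of phases after one step forces closeness of energies, so
`e^{-iHt} P_k w ≈ e^{-iE_k t} P_k w` with an error linear in `|t|`
(`NearlyCyclic.norm_amp_propagator_sub`). Moreover `M₀ P_k w ≈ w / N`, because only the zeroth term
of the Fourier sum survives `M₀`.

Hence `A_l = √N M₀ P_l` satisfies `A_l P_k w ≈ δ_{lk} w / √N`, and `x ↦ ∑ |l⟩ ⊗ A_l x` sends `w = ∑
P_k w` close to `ψ̄ ⊗ w`. It is not isometric, but `B = ∑ A_l† A_l` nearly fixes each `P_k w`. The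
identity `4B/(1+B)² + (1-B)²/(1+B)² = 1` replaces it by an exact isometry into `ℂ^N ⊗ (E ⊕ E)` whose
defect part `(1-B)/(1+B)` almost vanishes on `P_k w`. The vector estimates become trace-norm
estimates by Cauchy–Schwarz for Hilbert–Schmidt operators (`traceNorm_le_of_hsSq`), with `γ` equal
to `ρ` on the first summand. -/

/-- The squared Hilbert–Schmidt norm `∑ᵢ ‖A bᵢ‖²`. -/
def hsSq {ι : Type*} (b : HilbertBasis ι ℂ E) (A : E →L[ℂ] F) : ENNReal :=
  ∑' i, ENNReal.ofReal (‖A (b i)‖ ^ 2)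

theorem hasSum_norm_inner_sq {ι : Type*} (b : HilbertBasis ι ℂ E) (x : E) :
    HasSum (fun i => ‖⟪b i, x⟫_ℂ‖ ^ 2) (‖x‖ ^ 2) := by
  have h := Complex.hasSum_re (b.hasSum_inner_mul_inner x x)
  convert h using 1
  · funext i
    rw [← Complex.normSq_eq_norm_sq, ← inner_conj_symm, Complex.mul_conj, Complex.ofReal_re,
      Complex.normSq_conj]
  · exact (inner_self_eq_norm_sq (𝕜 := ℂ) x).symm

theorem ofReal_norm_sq_eq_tsum {ι : Type*} (b : HilbertBasis ι ℂ E) (x : E) :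
    ENNReal.ofReal (‖x‖ ^ 2) = ∑' i, ENNReal.ofReal (‖⟪b i, x⟫_ℂ‖ ^ 2) := by
  have h := hasSum_norm_inner_sq b x
  rw [← h.tsum_eq, ENNReal.ofReal_tsum_of_nonneg (fun _ => by positivity) h.summable]

theorem hsSq_adjoint {ι κ : Type*} (b : HilbertBasis ι ℂ E) (c : HilbertBasis κ ℂ F)
    (A : E →L[ℂ] F) : hsSq c (adjoint A) = hsSq b A := by
  unfold hsSq
  simp_rw [ofReal_norm_sq_eq_tsum b (adjoint A _), ofReal_norm_sq_eq_tsum c (A _)]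
  rw [ENNReal.tsum_comm]
  refine tsum_congr fun i => tsum_congr fun j => ?_
  rw [adjoint_inner_right, norm_inner_symm]

theorem hsSq_comp_le {ι : Type*} (b : HilbertBasis ι ℂ E) (Y : F →L[ℂ] G) (A : E →L[ℂ] F) :
    hsSq b (Y ∘L A) ≤ ENNReal.ofReal (‖Y‖ ^ 2) * hsSq b A := by
  unfold hsSq
  rw [← ENNReal.tsum_mul_left]
  refine ENNReal.tsum_le_tsum fun i => ?_
  rw [← ENNReal.ofReal_mul (by positivity), ← mul_pow]
  gcongr
  exact Y.le_opNorm _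

/-- The Hilbert–Schmidt norm is invariant under adjoints and does not grow under left multiplication
by the contraction `W†`. -/
theorem sum_norm_adjoint_sq_le {ι κ : Type*} (b : HilbertBasis ι ℂ E) (c : HilbertBasis κ ℂ G)
    {A : E →L[ℂ] F} {a : ℝ} (hA : hsSq b A ≤ ENNReal.ofReal (a ^ 2)) {W : G →L[ℂ] F}
    (hW : ‖W‖ ≤ 1) (s : Finset κ) : ∑ i ∈ s, ‖adjoint A (W (c i))‖ ^ 2 ≤ a ^ 2 := by
  have h1 : hsSq c (adjoint (adjoint W ∘L A)) ≤ ENNReal.ofReal (a ^ 2) := by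
    rw [hsSq_adjoint b]
    refine (hsSq_comp_le b _ A).trans ?_
    refine (mul_le_mul' (ENNReal.ofReal_le_one.2 ?_) hA).trans (one_mul _).le
    rw [LinearIsometryEquiv.norm_map]
    exact pow_le_one₀ (norm_nonneg _) hW
  have h2 := (ENNReal.sum_le_tsum s).trans h1
  rw [← ENNReal.ofReal_sum_of_nonneg (fun _ _ => by positivity),
    ENNReal.ofReal_le_ofReal_iff (by positivity)] at h2
  simpa [adjoint_comp] using h2

theorem exists_right_inverse_add {P : E →L[ℂ] E} (hP : P.IsPositive) {ε : ℝ} (hε : 0 < ε) :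
    ∃ R : E →L[ℂ] E, (P + (ε : ℂ) • 1) * R = 1 := by
  have h0 : (0 : E →L[ℂ] E) ≤ P := (nonneg_iff_isPositive P).2 hP
  have h1 : IsStrictlyPositive ((ε : ℂ) • (1 : E →L[ℂ] E)) :=
    isStrictlyPositive_one.smul hε
  obtain ⟨u, hu⟩ := CStarAlgebra.isUnit_of_le _ (le_add_of_nonneg_left h0) h1
  exact ⟨↑u⁻¹, by rw [← hu]; simp⟩

/-- Hölder's inequality for two products at once. The polar part of `T` is replaced by the
contraction `W = T (|T| + ε)⁻¹`, so `tr |T|` is a limit of sums `∑ Re ⟨W eᵢ, T eᵢ⟩`, to which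
Cauchy–Schwarz applies. -/
theorem traceNorm_le_of_hsSq {ι : Type*} (b : HilbertBasis ι ℂ E) {A B C D : E →L[ℂ] F}
    {α β γ δ : ℝ} (hα : 0 ≤ α) (hβ : 0 ≤ β) (hγ : 0 ≤ γ) (hδ : 0 ≤ δ)
    (hA : hsSq b A ≤ ENNReal.ofReal (α ^ 2)) (hB : hsSq b B ≤ ENNReal.ofReal (β ^ 2))
    (hC : hsSq b C ≤ ENNReal.ofReal (γ ^ 2)) (hD : hsSq b D ≤ ENNReal.ofReal (δ ^ 2)) :
    traceNorm (A ∘L adjoint B + C ∘L adjoint D) ≤ ENNReal.ofReal (α * β + γ * δ) := by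
  set T := A ∘L adjoint B + C ∘L adjoint D with hT
  set P := CFC.abs T with hPdef
  have hP : P.IsPositive := (nonneg_iff_isPositive P).1 (CFC.abs_nonneg T)
  have hPP : P * P = adjoint T * T := CFC.abs_mul_abs T
  have hnorm : ∀ y, ‖T y‖ = ‖P y‖ := by
    intro y
    have h : ⟪y, (adjoint T * T) y⟫_ℂ = ⟪y, (P * P) y⟫_ℂ := by rw [hPP]
    simp only [mul_apply_eq_comp, adjoint_inner_right] at h
    rw [← hP.inner_left_eq_inner_right, inner_self_eq_norm_sq_to_K,
      inner_self_eq_norm_sq_to_K] at h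
    exact (sq_eq_sq₀ (norm_nonneg _) (norm_nonneg _)).1 (by exact_mod_cast h)
  set e := onb F
  have hsum : ∀ {X Y : E →L[ℂ] F} {x y : ℝ}, 0 ≤ x → 0 ≤ y →
      hsSq b X ≤ ENNReal.ofReal (x ^ 2) → hsSq b Y ≤ ENNReal.ofReal (y ^ 2) →
      ∀ (W : F →L[ℂ] F), ‖W‖ ≤ 1 → ∀ s : Finset (basisIndex F),
      ∑ i ∈ s, (⟪W (e i), (X ∘L adjoint Y) (e i)⟫_ℂ).re ≤ x * y := by
    intro X Y x y hx hy hX hY W hW s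
    calc _ ≤ ∑ i ∈ s, ‖adjoint X (W (e i))‖ * ‖adjoint Y (e i)‖ := by
          refine Finset.sum_le_sum fun i _ => ?_
          rw [comp_apply, ← adjoint_inner_left]
          exact (Complex.re_le_norm _).trans (norm_inner_le_norm _ _)
      _ ≤ _ := Real.sum_mul_le_sqrt_mul_sqrt _ _ _
      _ ≤ x * y := by
          refine mul_le_mul (Real.sqrt_le_iff.2 ⟨hx, sum_norm_adjoint_sq_le b e hX hW s⟩)
            (Real.sqrt_le_iff.2 ⟨hy, ?_⟩) (Real.sqrt_nonneg _) hx
          exact sum_norm_adjoint_sq_le b e hY (W := 1) norm_id_le s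
  have key : ∀ s : Finset (basisIndex F), ∑ i ∈ s, (⟪e i, P (e i)⟫_ℂ).re ≤ α * β + γ * δ := by
    intro s
    -- Each basis vector costs an error `ε`; the partial sum is finite, so `ε` may tend to zero
    -- afterwards.
    have hε : ∀ ε : ℝ, 0 < ε →
        ∑ i ∈ s, (⟪e i, P (e i)⟫_ℂ).re ≤ α * β + γ * δ + ε * s.card := by
      intro ε hε
      obtain ⟨R, hR⟩ := exists_right_inverse_add hP hε
      have hx : ∀ x, P (R x) + (ε : ℂ) • R x = x := fun x => by
        simpa using congrArg (fun X : F →L[ℂ] F => X x) hR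
      have hPR : ∀ x, ‖P (R x)‖ ≤ ‖x‖ := by
        intro x
        -- In `x = P R x + ε R x` the cross term is nonnegative because `P` is positive, hence `P R`
        -- is a contraction.
        have h1 : 0 ≤ (⟪P (R x), R x⟫_ℂ).re := hP.re_inner_nonneg_left (R x)
        have h2 : ‖x‖ ^ 2 = ‖P (R x)‖ ^ 2 + 2 * (ε * (⟪P (R x), R x⟫_ℂ).re)
            + ‖(ε : ℂ) • R x‖ ^ 2 := by
          conv_lhs => rw [← hx x]
          rw [norm_add_sq (𝕜 := ℂ), inner_smul_right]
          simp
        refine le_of_sq_le_sq ?_ (norm_nonneg _)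
        have := mul_nonneg hε.le h1
        nlinarith [sq_nonneg ‖(ε : ℂ) • R x‖]
      have hW : ‖T * R‖ ≤ 1 := by
        refine opNorm_le_bound _ zero_le_one fun x => ?_
        rw [mul_apply_eq_comp, hnorm, one_mul]
        exact hPR x
      have hi : ∀ i, (⟪e i, P (e i)⟫_ℂ).re ≤ (⟪(T * R) (e i), T (e i)⟫_ℂ).re + ε := by
        intro i
        have h1 : ⟪(T * R) (e i), T (e i)⟫_ℂ = ⟪P (R (e i)), P (e i)⟫_ℂ := by
          rw [mul_apply_eq_comp, ← adjoint_inner_right, ← mul_apply_eq_comp, ← hPP, mul_apply_eq_comp,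
            hP.inner_left_eq_inner_right]
        have h2 : ⟪e i, P (e i)⟫_ℂ = ⟪P (R (e i)), P (e i)⟫_ℂ + ε * ⟪P (R (e i)), e i⟫_ℂ := by
          conv_lhs => rw [← hx (e i)]
          rw [inner_add_left, inner_smul_left, hx, ← hP.inner_left_eq_inner_right (R (e i))]
          rw [Complex.conj_ofReal]
        have h3 : (⟪P (R (e i)), e i⟫_ℂ).re ≤ 1 := by
          refine (Complex.re_le_norm _).trans ((norm_inner_le_norm _ _).trans ?_)
          have h4 : ‖e i‖ = 1 := e.orthonormal.1 i
          rw [h4, mul_one, ← h4]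
          exact hPR _
        rw [h1, h2, Complex.add_re, Complex.re_ofReal_mul]
        nlinarith
      calc _ ≤ ∑ i ∈ s, ((⟪(T * R) (e i), T (e i)⟫_ℂ).re + ε) :=
            Finset.sum_le_sum fun i _ => hi i
        _ = ∑ i ∈ s, (⟪(T * R) (e i), (A ∘L adjoint B) (e i)⟫_ℂ).re
            + ∑ i ∈ s, (⟪(T * R) (e i), (C ∘L adjoint D) (e i)⟫_ℂ).re + ε * s.card := by
            rw [Finset.sum_add_distrib, Finset.sum_const, nsmul_eq_mul, mul_comm ε,
              ← Finset.sum_add_distrib]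
            congr 1
            refine Finset.sum_congr rfl fun i _ => ?_
            rw [hT, add_apply, inner_add_right, Complex.add_re]
        _ ≤ _ := by
            have := hsum hα hβ hA hB _ hW s
            have := hsum hγ hδ hC hD _ hW s
            linarith
    refine le_of_forall_pos_le_add fun ε hpos => ?_
    have hc : (0 : ℝ) < s.card + 1 := by positivity
    refine (hε (ε / (s.card + 1)) (by positivity)).trans ?_
    have : ε / (s.card + 1) * s.card ≤ ε := by
      rw [div_mul_eq_mul_div, div_le_iff₀ hc]
      nlinarith
    linarith
  unfold traceNorm
  rw [ENNReal.tsum_eq_iSup_sum]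
  refine iSup_le fun s => ?_
  rw [← ENNReal.ofReal_sum_of_nonneg (fun i _ => by exact hP.re_inner_nonneg_right (e i))]
  exact ENNReal.ofReal_le_ofReal (key s)

theorem summable_of_hsSq_ne_top {ι : Type*} {b : HilbertBasis ι ℂ E} {A : E →L[ℂ] F}
    (hA : hsSq b A ≠ ⊤) : Summable fun i => ‖A (b i)‖ ^ 2 := by
  have h := ENNReal.summable_toReal hA
  simpa [ENNReal.toReal_ofReal, sq_nonneg] using h

/-- Cyclicity of the trace in the form `tr (A B†) = ∑ⱼ ⟨B bⱼ, A bⱼ⟩`. -/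
theorem trace_comp_adjoint {ι : Type*} (b : HilbertBasis ι ℂ E) {A B : E →L[ℂ] F}
    (hA : hsSq b A ≠ ⊤) (hB : hsSq b B ≠ ⊤) :
    trace (A ∘L adjoint B) = ∑' j, ⟪B (b j), A (b j)⟫_ℂ := by
  set e := onb F
  have hprod : ∀ {X : E →L[ℂ] F}, hsSq b X ≠ ⊤ →
      Summable fun p : ι × basisIndex F => ‖⟪e p.2, X (b p.1)⟫_ℂ‖ ^ 2 := by
    intro X hX
    refine (summable_prod_of_nonneg fun _ => by positivity).2
      ⟨fun j => (hasSum_norm_inner_sq e (X (b j))).summable, ?_⟩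
    simp_rw [(hasSum_norm_inner_sq e (X (b _))).tsum_eq]
    exact summable_of_hsSq_ne_top hX
  have hs : Summable (Function.uncurry fun (j : ι) (i : basisIndex F) =>
      ⟪B (b j), e i⟫_ℂ * ⟪e i, A (b j)⟫_ℂ) := by
    refine Summable.of_norm_bounded ((hprod hA).add (hprod hB)) fun p => ?_
    simp only [Function.uncurry, norm_mul]
    rw [norm_inner_symm]
    nlinarith [sq_nonneg (‖⟪e p.2, A (b p.1)⟫_ℂ‖ - ‖⟪e p.2, B (b p.1)⟫_ℂ‖),
      sq_nonneg (‖⟪e p.2, A (b p.1)⟫_ℂ‖), sq_nonneg ‖⟪e p.2, B (b p.1)⟫_ℂ‖]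
  have h1 : ∀ j, ⟪B (b j), A (b j)⟫_ℂ = ∑' i, ⟪B (b j), e i⟫_ℂ * ⟪e i, A (b j)⟫_ℂ :=
    fun j => (e.hasSum_inner_mul_inner _ _).tsum_eq.symm
  simp_rw [h1]
  rw [← hs.tsum_comm]
  unfold trace
  refine tsum_congr fun i => ?_
  rw [comp_apply, ← adjoint_inner_left, ← (b.hasSum_inner_mul_inner _ _).tsum_eq]
  refine tsum_congr fun j => ?_
  rw [adjoint_inner_left, adjoint_inner_right, mul_comm]

end HilbertSchmidt

/-! ### Operators acting on square-summable families of vectors -/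

section Amplification

variable {ι E F G : Type*} [NormedAddCommGroup E] [InnerProductSpace ℂ E]
  [NormedAddCommGroup F] [InnerProductSpace ℂ F] [NormedAddCommGroup G] [InnerProductSpace ℂ G]

theorem memlp_two_iff {f : ι → F} : Memℓp f 2 ↔ Summable fun i => ‖f i‖ ^ 2 := by
  rw [memℓp_gen_iff (by norm_num)]
  norm_num

/-- The family `(X wᵢ)ᵢ`, as a linear function of the operator `X`. -/
def amp (w : lp (fun _ : ι => E) 2) : (E →L[ℂ] F) →ₗ[ℂ] lp (fun _ : ι => F) 2 where
  toFun X := ⟨fun i => X (w i), by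
    refine memlp_two_iff.2 (Summable.of_nonneg_of_le (fun _ => by positivity) (fun i => ?_)
      ((memlp_two_iff.1 w.2).mul_left (‖X‖ ^ 2)))
    rw [← mul_pow]
    gcongr
    exact X.le_opNorm _⟩
  map_add' _ _ := rfl
  map_smul' _ _ := rfl

variable (w : lp (fun _ : ι => E) 2)

theorem amp_apply (X : E →L[ℂ] F) (i : ι) : amp w X i = X (w i) := rfl

theorem lp_norm_sq_eq_tsum (f : lp (fun _ : ι => F) 2) : ‖f‖ ^ 2 = ∑' i, ‖f i‖ ^ 2 := by
  have := lp.norm_rpow_eq_tsum (p := 2) (by norm_num) f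
  norm_num at this
  exact this

theorem norm_amp_mono {X : E →L[ℂ] F} {Y : E →L[ℂ] G} (h : ∀ x, ‖X x‖ ≤ ‖Y x‖) :
    ‖amp w X‖ ≤ ‖amp w Y‖ := by
  refine le_of_sq_le_sq ?_ (norm_nonneg _)
  rw [lp_norm_sq_eq_tsum, lp_norm_sq_eq_tsum]
  refine Summable.tsum_le_tsum (fun i => ?_) (memlp_two_iff.1 (amp w X).2)
    (memlp_two_iff.1 (amp w Y).2)
  rw [amp_apply, amp_apply]
  gcongr
  exact h _

theorem norm_amp_comp_le (Y : F →L[ℂ] G) (X : E →L[ℂ] F) :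
    ‖amp w (Y ∘L X)‖ ≤ ‖Y‖ * ‖amp w X‖ := by
  have h : ‖amp w (Y ∘L X)‖ ≤ ‖amp w ((‖Y‖ : ℂ) • X)‖ := by
    refine norm_amp_mono w fun x => ?_
    simpa [norm_smul] using Y.le_opNorm (X x)
  simpa [norm_smul] using h

theorem norm_amp_mul_le (Y X : E →L[ℂ] E) : ‖amp w (Y * X)‖ ≤ ‖Y‖ * ‖amp w X‖ :=
  norm_amp_comp_le w Y X

theorem norm_amp_mul_le_of_norm_le_one {Y : E →L[ℂ] E} (hY : ‖Y‖ ≤ 1) (X : E →L[ℂ] E) :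
    ‖amp w (Y * X)‖ ≤ ‖amp w X‖ :=
  (norm_amp_mul_le w Y X).trans (mul_le_of_le_one_left (norm_nonneg _) hY)

theorem amp_one : amp w (1 : E →L[ℂ] E) = w := rfl

theorem inner_amp (X Y : E →L[ℂ] F) : ⟪amp w X, amp w Y⟫_ℂ = ∑' i, ⟪X (w i), Y (w i)⟫_ℂ :=
  lp.inner_eq_tsum _ _

theorem inner_amp_eq [CompleteSpace E] [CompleteSpace F] (X Y : E →L[ℂ] F) :
    ⟪amp w X, amp w Y⟫_ℂ = ⟪w, amp w (adjoint X ∘L Y)⟫_ℂ := by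
  refine (inner_amp w X Y).trans ((tsum_congr fun i => ?_).trans (lp.inner_eq_tsum _ _).symm)
  exact (adjoint_inner_right X (w i) (Y (w i))).symm

theorem re_inner_amp_nonneg {P : E →L[ℂ] E} (hP : P.IsPositive) :
    0 ≤ (⟪w, amp w P⟫_ℂ).re := by
  rw [lp.inner_eq_tsum, Complex.re_tsum (lp.summable_inner (𝕜 := ℂ) w (amp w P))]
  exact tsum_nonneg fun i => hP.re_inner_nonneg_right (w i)

end Amplification

/-! ### Functions of a bounded self-adjoint operator -/

section FunctionalCalculus

variable {E : Type*} [NormedAddCommGroup E] [InnerProductSpace ℂ E] [CompleteSpace E]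
  {H : E →L[ℂ] E}

theorem exp_smul_eq_cfc (hH : IsSelfAdjoint H) (c : ℂ) :
    NormedSpace.exp (c • H) = cfc (fun z : ℂ => Complex.exp (c * z)) H := by
  have hn : IsStarNormal H := hH.isStarNormal
  have hn' : IsStarNormal (c • H) := inferInstance
  rw [← CFC.complex_exp_eq_normedSpace_exp hn', ← cfc_comp_smul c Complex.exp H]
  rfl

theorem mem_spectrum_complex (hH : IsSelfAdjoint H) {Λ : ℝ}
    (hs : spectrum ℝ H ⊆ Set.Icc 0 Λ) {z : ℂ} (hz : z ∈ spectrum ℂ H) :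
    ∃ x ∈ Set.Icc 0 Λ, z = (x : ℂ) := by
  rw [← hH.spectrumRestricts.algebraMap_image] at hz
  obtain ⟨x, hx, rfl⟩ := hz
  exact ⟨x, hs hx, rfl⟩

open scoped ComplexOrder in
theorem isPositive_cfc (hH : IsSelfAdjoint H) {Λ : ℝ} (hs : spectrum ℝ H ⊆ Set.Icc 0 Λ)
    {g : ℂ → ℂ} (hg : ∀ x ∈ Set.Icc 0 Λ, ∃ r : ℝ, 0 ≤ r ∧ g (x : ℝ) = r) :
    (cfc g H).IsPositive := by
  rw [← nonneg_iff_isPositive]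
  refine cfc_nonneg fun z hz => ?_
  obtain ⟨x, hx, rfl⟩ := mem_spectrum_complex hH hs hz
  obtain ⟨r, hr, h⟩ := hg x hx
  rw [h]
  exact_mod_cast hr

/-- The function `|h|² - |g|²` is nonnegative on the spectrum, so its operator is positive; its
expectation in `y` is the difference of the squared norms. -/
theorem norm_cfc_apply_le (hH : IsSelfAdjoint H) {Λ : ℝ} (hs : spectrum ℝ H ⊆ Set.Icc 0 Λ)
    {g h : ℂ → ℂ} (hg : Continuous g) (hh : Continuous h)
    (hle : ∀ x ∈ Set.Icc 0 Λ, ‖g (x : ℝ)‖ ≤ ‖h (x : ℝ)‖) (y : E) :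
    ‖cfc g H y‖ ≤ ‖cfc h H y‖ := by
  have hn : IsStarNormal H := hH.isStarNormal
  have hpos : (cfc (fun z => star (h z) * h z - star (g z) * g z) H).IsPositive := by
    refine isPositive_cfc hH hs fun x hx => ⟨‖h x‖ ^ 2 - ‖g x‖ ^ 2, ?_, ?_⟩
    · have := hle x hx
      have := pow_le_pow_left₀ (norm_nonneg _) this 2
      linarith
    · simp [Complex.conj_mul']
  rw [cfc_sub _ _ H, cfc_mul _ _ H, cfc_mul _ _ H, cfc_star, cfc_star] at hpos
  have h1 := hpos.re_inner_nonneg_right y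
  have h2 : ∀ X : E →L[ℂ] E, ⟪y, (star X * X) y⟫_ℂ = (‖X y‖ ^ 2 : ℝ) := by
    intro X
    rw [star_eq_adjoint, mul_apply_eq_comp, adjoint_inner_right, inner_self_eq_norm_sq_to_K]
    norm_cast
  rw [sub_apply, inner_sub_right, h2, h2] at h1
  refine le_of_sq_le_sq ?_ (norm_nonneg _)
  rw [← Complex.ofReal_sub] at h1
  exact sub_nonneg.1 h1

end FunctionalCalculus

/-! ### Trigonometric estimates -/

section Trigonometry

/-- The sine-weighted cosine polynomial `∑_{k<n} 2 sin(kb) cos(kx)`. -/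
def sineKernel (n : ℕ) (b x : ℝ) : ℝ :=
  ∑ k ∈ Finset.range n, 2 * Real.sin (k * b) * Real.cos (k * x)

/-- A Christoffel–Darboux type telescoping. At `n b = π` the right side collapses to `sin b (1 + cos
(n x))`, which fixes the sign of the kernel. -/
theorem cos_sub_cos_mul_sineKernel (n : ℕ) (b x : ℝ) :
    (Real.cos x - Real.cos b) * sineKernel n b x =
      Real.sin ((n - 1) * b) * Real.cos (n * x) - Real.sin (n * b) * Real.cos ((n - 1) * x)
        + Real.sin b := by
  unfold sineKernel
  induction n with
  | zero => simp
  | succ n ih =>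
    rw [Finset.sum_range_succ, mul_add, ih]
    push_cast
    have h1 : ((n : ℝ) + 1) * b = n * b + b := by ring
    have h2 : ((n : ℝ) + 1) * x = n * x + x := by ring
    have h3 : ((n : ℝ) - 1) * b = n * b - b := by ring
    have h4 : ((n : ℝ) - 1) * x = n * x - x := by ring
    rw [add_sub_cancel_right, h1, h2, h3, h4, Real.sin_add, Real.sin_sub, Real.cos_add,
      Real.cos_sub]
    ring

theorem cos_nat_mul_congr {x b : ℝ} (h : Real.cos x = Real.cos b) (k : ℕ) :
    Real.cos (k * x) = Real.cos (k * b) := by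
  have h1 := Polynomial.Chebyshev.T_real_cos x k
  have h2 := Polynomial.Chebyshev.T_real_cos b k
  rw [h, h2] at h1
  exact_mod_cast h1.symm

/-- Supplies the value of the kernel at `x = b`, where the factor `cos x - cos b` vanishes and
cannot be divided out. -/
theorem sin_mul_sineKernel_self (n : ℕ) (b : ℝ) :
    2 * Real.sin b * sineKernel n b b = Real.cos b - Real.cos ((2 * n - 1) * b) := by
  unfold sineKernel
  induction n with
  | zero => simp
  | succ n ih =>
    rw [Finset.sum_range_succ, mul_add, ih]
    push_cast
    have h1 : (2 * ((n : ℝ) + 1) - 1) * b = 2 * (n * b) + b := by ring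
    have h2 : (2 * (n : ℝ) - 1) * b = 2 * (n * b) - b := by ring
    rw [h1, h2, Real.cos_add, Real.cos_sub, Real.sin_two_mul]
    ring

theorem sin_pi_div_pos {N : ℕ} (hN : 2 ≤ N) : 0 < Real.sin (Real.pi / N) := by
  have h2 : (2 : ℝ) ≤ N := by exact_mod_cast hN
  refine Real.sin_pos_of_pos_of_lt_pi (by positivity) ?_
  rw [div_lt_iff₀ (by positivity)]
  nlinarith [Real.pi_pos]

theorem cos_le_cos_of_mem_Icc {b x : ℝ} (hb : 0 ≤ b) (h1 : b ≤ x) (h2 : x ≤ 2 * Real.pi - b) :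
    Real.cos x ≤ Real.cos b := by
  rcases le_total x Real.pi with h | h
  · exact Real.cos_le_cos_of_nonneg_of_le_pi hb h h1
  · rw [← Real.cos_two_pi_sub x]
    exact Real.cos_le_cos_of_nonneg_of_le_pi hb (by linarith) (by linarith)

/-- On this arc `cos x ≤ cos b`, so the telescoped identity gives `(cos b - cos x) (-S) = sin b (1 +
cos (N x))`, where `S` is the kernel; then use `cos b - cos x ≤ 2`. -/
theorem one_add_cos_le_neg_sineKernel {N : ℕ} (hN : 2 ≤ N) {x : ℝ} (h1 : Real.pi / N ≤ x)
    (h2 : x ≤ 2 * Real.pi - Real.pi / N) :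
    Real.sin (Real.pi / N) * (1 + Real.cos (N * x)) ≤ 2 * -sineKernel N (Real.pi / N) x := by
  set b := Real.pi / N with hb
  have hN0 : (N : ℝ) ≠ 0 := by positivity
  have hNb : N * b = Real.pi := by rw [hb]; field_simp
  have hs := sin_pi_div_pos hN
  rw [← hb] at hs
  have hle := cos_le_cos_of_mem_Icc (b := b) (by positivity) h1 h2
  have hid := cos_sub_cos_mul_sineKernel N b x
  have e1 : ((N : ℝ) - 1) * b = Real.pi - b := by rw [sub_mul, hNb, one_mul]
  rw [e1, hNb, Real.sin_pi_sub, Real.sin_pi] at hid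
  have hc : 0 ≤ 1 + Real.cos (N * x) := by linarith [Real.neg_one_le_cos (N * x)]
  rcases hle.lt_or_eq with hlt | heq
  · have hK : 0 ≤ -sineKernel N b x := by
      by_contra hneg
      push Not at hneg
      nlinarith [mul_nonneg hs.le hc]
    nlinarith [Real.cos_le_one b, Real.neg_one_le_cos x]
  -- At the ends of the arc both sides vanish: the kernel is a polynomial in `cos x`, and `cos (N b)
  -- = -1`.
  · have hK : sineKernel N b x = sineKernel N b b :=
      Finset.sum_congr rfl fun k _ => by rw [cos_nat_mul_congr heq]
    have h3 := sin_mul_sineKernel_self N b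
    have e2 : (2 * (N : ℝ) - 1) * b = 2 * Real.pi - b := by
      rw [sub_mul, mul_assoc, hNb, one_mul]
    rw [e2, Real.cos_two_pi_sub, sub_self] at h3
    have h4 : sineKernel N b b = 0 := by
      rcases mul_eq_zero.1 h3 with h | h
      · nlinarith
      · exact h
    rw [hK, h4, cos_nat_mul_congr heq, hNb, Real.cos_pi]
    simp

/-- Jordan's inequality up to `π / 2`; beyond that `sin z ≥ sin b` and `z ≤ π`. -/
theorem sin_mul_abs_le {b y : ℝ} (hb : 0 ≤ b) (hb' : b ≤ Real.pi / 2) (hy : |y| ≤ Real.pi - b) :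
    Real.sin b * |y| ≤ Real.pi * |Real.sin y| := by
  have hpi := Real.pi_pos
  have hsb : 0 ≤ Real.sin b := Real.sin_nonneg_of_nonneg_of_le_pi hb (by linarith)
  have key : ∀ z, 0 ≤ z → z ≤ Real.pi - b → Real.sin b * z ≤ Real.pi * Real.sin z := by
    intro z hz hz'
    rcases le_total z (Real.pi / 2) with h | h
    · have h1 := Real.mul_le_sin hz h
      have h2 := Real.sin_le_one b
      have h3 : Real.pi * (2 / Real.pi * z) = 2 * z := by field_simp
      nlinarith
    · have h1 : Real.sin b ≤ Real.sin z := by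
        rw [← Real.sin_pi_sub z]
        exact Real.sin_le_sin_of_le_of_le_pi_div_two (by linarith) (by linarith) (by linarith)
      nlinarith
  rcases le_total 0 y with h | h
  · rw [abs_of_nonneg h] at hy ⊢
    exact (key y h hy).trans (mul_le_mul_of_nonneg_left (le_abs_self _) hpi.le)
  · rw [abs_of_nonpos h] at hy ⊢
    have := key (-y) (by linarith) hy
    rw [Real.sin_neg] at this
    exact this.trans (mul_le_mul_of_nonneg_left (neg_le_abs _) hpi.le)

theorem norm_exp_sub_exp (a b : ℝ) :
    ‖Complex.exp (-(Complex.I * a)) - Complex.exp (-(Complex.I * b))‖ =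
      ‖Complex.exp (Complex.I * ((b - a : ℝ) : ℂ)) - 1‖ := by
  have h : Complex.exp (-(Complex.I * a)) - Complex.exp (-(Complex.I * b)) =
      Complex.exp (((-b : ℝ) : ℂ) * Complex.I) *
        (Complex.exp (Complex.I * ((b - a : ℝ) : ℂ)) - 1) := by
    rw [mul_sub, ← Complex.exp_add, mul_one]
    congr 2 <;> push_cast <;> ring
  rw [h, norm_mul, Complex.norm_exp_ofReal_mul_I, one_mul]

theorem norm_exp_sub_exp_le (a b : ℝ) :
    ‖Complex.exp (-(Complex.I * a)) - Complex.exp (-(Complex.I * b))‖ ≤ |a - b| := by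
  rw [norm_exp_sub_exp, abs_sub_comm]
  exact Real.norm_exp_I_mul_ofReal_sub_one_le

theorem abs_sub_le_norm_exp_sub_exp {N : ℕ} (hN : 2 ≤ N) {a b : ℝ}
    (h : |a - b| ≤ 2 * Real.pi - 2 * (Real.pi / N)) :
    |a - b| ≤ Real.pi / Real.sin (Real.pi / N) *
      ‖Complex.exp (-(Complex.I * a)) - Complex.exp (-(Complex.I * b))‖ := by
  have hs := sin_pi_div_pos hN
  have h2 : (2 : ℝ) ≤ N := by exact_mod_cast hN
  rw [norm_exp_sub_exp, Complex.norm_exp_I_mul_ofReal_sub_one, abs_sub_comm, div_mul_eq_mul_div,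
    le_div_iff₀ hs]
  have hy : |(b - a) / 2| ≤ Real.pi - Real.pi / N := by
    rw [abs_div, abs_two, abs_sub_comm]
    linarith
  have hb : Real.pi / N ≤ Real.pi / 2 := by gcongr
  have := sin_mul_abs_le (by positivity) hb hy
  rw [abs_div, abs_two] at this
  rw [norm_mul, Real.norm_eq_abs, Real.norm_eq_abs, abs_two]
  linarith

theorem norm_exp_sub_one_sq (x : ℝ) :
    ‖Complex.exp (-(Complex.I * x)) - 1‖ ^ 2 = 2 - 2 * Real.cos x := by
  have h : -(Complex.I * x) = ((-x : ℝ) : ℂ) * Complex.I := by push_cast; ring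
  rw [h, ← Complex.normSq_eq_norm_sq, Complex.normSq_apply]
  simp only [Complex.sub_re, Complex.sub_im, Complex.exp_ofReal_mul_I_re,
    Complex.exp_ofReal_mul_I_im, Complex.one_re, Complex.one_im, Real.cos_neg, Real.sin_neg]
  nlinarith [Real.sin_sq_add_cos_sq x]

end Trigonometry

/-! ### Approximate level projections and the Cayley-type dilation -/

/-- The primitive root of unity `e^{2πi/N}`. -/
def unityRoot (N : ℕ) : ℂ := Complex.exp (2 * Real.pi * Complex.I / N)

theorem isPrimitiveRoot_unityRoot {N : ℕ} (hN : N ≠ 0) : IsPrimitiveRoot (unityRoot N) N :=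
  Complex.isPrimitiveRoot_exp N hN

theorem norm_unityRoot {N : ℕ} (hN : N ≠ 0) : ‖unityRoot N‖ = 1 :=
  (isPrimitiveRoot_unityRoot hN).norm'_eq_one hN

theorem unityRoot_ne_zero {N : ℕ} (hN : N ≠ 0) : unityRoot N ≠ 0 :=
  (isPrimitiveRoot_unityRoot hN).ne_zero hN

theorem average_unityRoot_pow {N : ℕ} (l k : Fin N) :
    (N : ℂ)⁻¹ * ∑ j ∈ Finset.range N,
      (unityRoot N ^ (l : ℕ) * (unityRoot N ^ (k : ℕ))⁻¹) ^ j = if l = k then 1 else 0 := by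
  have hN : N ≠ 0 := by have := l.2; omega
  have hp := isPrimitiveRoot_unityRoot hN
  have h0 : ∀ n : ℕ, unityRoot N ^ n ≠ 0 := fun n => pow_ne_zero _ (unityRoot_ne_zero hN)
  set a := unityRoot N ^ (l : ℕ) * (unityRoot N ^ (k : ℕ))⁻¹ with ha
  split_ifs with h
  · have : a = 1 := by rw [ha, h, mul_inv_cancel₀ (h0 _)]
    simp [this, hN]
  · have h1 : a ≠ 1 := by
      intro h1
      rw [ha, mul_inv_eq_one₀ (h0 _)] at h1
      exact h (Fin.ext (hp.pow_inj l.2 k.2 h1))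
    have h2 : a ^ N = 1 := by
      rw [ha, mul_pow, inv_pow, pow_right_comm, pow_right_comm (unityRoot N) (k : ℕ),
        hp.pow_eq_one]
      simp
    have h3 := mul_geom_sum a N
    rw [h2, sub_self] at h3
    rw [(mul_eq_zero.1 h3).resolve_left (sub_ne_zero.2 h1), mul_zero]

section Levels

variable {ι E F : Type*} [NormedAddCommGroup E] [InnerProductSpace ℂ E] [CompleteSpace E]
  [NormedAddCommGroup F] [InnerProductSpace ℂ F]

/-- The discrete Fourier component `N⁻¹ ∑_{j<N} (e^{2πik/N} U)^j`. If `U^N = 1`, it is the projection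
onto the eigenspace of `U` with eigenvalue `e^{-2πik/N}`. -/
def levelOp {N : ℕ} (U : E →L[ℂ] E) (k : Fin N) : E →L[ℂ] E :=
  (N : ℂ)⁻¹ • ∑ j ∈ Finset.range N, (unityRoot N ^ (k : ℕ) • U) ^ j

/-- Up to `η` and `ζ`, the family `w` is in `M₀`, its images under `U, …, U^(N-1)` are in
`1 - M₀`, and it is fixed by `U^N`. -/
structure NearlyCyclic (N : ℕ) (w : lp (fun _ : ι => E) 2) (U M₀ : E →L[ℂ] E) (η ζ : ℝ) :
    Prop where
  two_le : 2 ≤ N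
  star_mul_self : star U * U = 1
  isSelfAdjoint : IsSelfAdjoint M₀
  norm_le : ‖M₀‖ ≤ 1
  norm_one_sub : ‖amp w (1 - M₀)‖ ≤ η
  norm_mul_pow : ∀ j, 0 < j → j < N → ‖amp w (M₀ * U ^ j)‖ ≤ η
  norm_pow_sub_one : ‖amp w (U ^ N - 1)‖ ≤ ζ

theorem norm_le_one_of_star_mul_self {U : E →L[ℂ] E} (h : star U * U = 1) : ‖U‖ ≤ 1 := by
  have h1 := CStarRing.norm_star_mul_self (x := U)
  rw [h] at h1
  have h2 : ‖(1 : E →L[ℂ] E)‖ ≤ 1 := norm_id_le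
  nlinarith [norm_nonneg U]

theorem norm_amp_average_le (w : lp (fun _ : ι => E) 2) {N : ℕ} {c : ℕ → ℂ}
    (hc : ∀ j, ‖c j‖ ≤ 1) {Q : ℕ → E →L[ℂ] F} {ζ : ℝ} (hζ : 0 ≤ ζ)
    (hQ : ∀ j < N, ‖amp w (Q j)‖ ≤ ζ) :
    ‖amp w ((N : ℂ)⁻¹ • ∑ j ∈ Finset.range N, c j • Q j)‖ ≤ ζ := by
  rcases Nat.eq_zero_or_pos N with rfl | hN
  · simpa using hζ
  rw [map_smul, map_sum, norm_smul, norm_inv, Complex.norm_natCast,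
    inv_mul_le_iff₀ (by exact_mod_cast hN)]
  refine (norm_sum_le _ _).trans ((Finset.sum_le_card_nsmul _ _ ζ fun j hj => ?_).trans ?_)
  · rw [map_smul, norm_smul]
    exact (mul_le_of_le_one_left (norm_nonneg _) (hc j)).trans (hQ j (Finset.mem_range.1 hj))
  · simp

namespace NearlyCyclic

variable {N : ℕ} {w : lp (fun _ : ι => E) 2} {U M₀ : E →L[ℂ] E} {η ζ : ℝ}

theorem ne_zero (h : NearlyCyclic N w U M₀ η ζ) : N ≠ 0 := by have := h.two_le; omega

theorem one_le_cast (h : NearlyCyclic N w U M₀ η ζ) : (1 : ℝ) ≤ N := by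
  have := h.two_le
  exact_mod_cast (by omega : 1 ≤ N)

theorem eta_nonneg (h : NearlyCyclic N w U M₀ η ζ) : 0 ≤ η := (norm_nonneg _).trans h.norm_one_sub

theorem zeta_nonneg (h : NearlyCyclic N w U M₀ η ζ)
    : 0 ≤ ζ := (norm_nonneg _).trans h.norm_pow_sub_one

theorem norm_phase_pow (h : NearlyCyclic N w U M₀ η ζ) (k j : ℕ) : ‖(unityRoot N ^ k) ^ j‖ = 1 := by
  rw [norm_pow, norm_pow, norm_unityRoot h.ne_zero, one_pow, one_pow]

theorem phase_star_mul_self (h : NearlyCyclic N w U M₀ η ζ) (k : ℕ) :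
    star (unityRoot N ^ k • U) * (unityRoot N ^ k • U) = 1 := by
  have h1 := h.norm_phase_pow k 1
  rw [pow_one] at h1
  rw [star_smul, smul_mul_smul_comm, h.star_mul_self, Complex.star_def, Complex.conj_mul', h1]
  simp

theorem star_pow_mul_pow (h : NearlyCyclic N w U M₀ η ζ) (k j : ℕ) :
    star ((unityRoot N ^ k • U) ^ j) * (unityRoot N ^ k • U) ^ j = 1 := by
  induction j with
  | zero => simp
  | succ j ih =>
    rw [pow_succ, star_mul, mul_assoc, ← mul_assoc (star _) (_ ^ j), ih, one_mul,
      h.phase_star_mul_self]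

theorem norm_phase_pow_le (h : NearlyCyclic N w U M₀ η ζ)
    (k j : ℕ) : ‖(unityRoot N ^ k • U) ^ j‖ ≤ 1 :=
  norm_le_one_of_star_mul_self (h.star_pow_mul_pow k j)

theorem phase_sub_one_mul_levelOp (h : NearlyCyclic N w U M₀ η ζ) (k : Fin N) :
    (unityRoot N ^ (k : ℕ) • U - 1) * levelOp U k = (N : ℂ)⁻¹ • (U ^ N - 1) := by
  rw [levelOp, mul_smul_comm, mul_geom_sum, smul_pow, ← pow_mul, mul_comm (k : ℕ), pow_mul,
    (isPrimitiveRoot_unityRoot h.ne_zero).pow_eq_one, one_pow, one_smul]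

theorem norm_amp_phase_sub_one (h : NearlyCyclic N w U M₀ η ζ) (k : Fin N) :
    ‖amp w ((unityRoot N ^ (k : ℕ) • U - 1) * levelOp U k)‖ ≤ ζ / N := by
  rw [h.phase_sub_one_mul_levelOp, map_smul, norm_smul, norm_inv, Complex.norm_natCast,
    div_eq_inv_mul]
  gcongr
  exact h.norm_pow_sub_one

/-- Since `u^j - 1 = (∑_{i<j} u^i)(u - 1)`, at most a factor `N` is lost, and the `1 / N` in
`levelOp` pays for it. -/
theorem norm_amp_pow_sub (h : NearlyCyclic N w U M₀ η ζ) (k : Fin N) {j : ℕ} (hj : j < N) :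
    ‖amp w ((unityRoot N ^ (k : ℕ) • U) ^ j * levelOp U k - levelOp U k)‖ ≤ ζ := by
  set u := unityRoot N ^ (k : ℕ) • U with hu
  have h1 : u ^ j * levelOp U k - levelOp U k =
      (∑ i ∈ Finset.range j, u ^ i) * ((u - 1) * levelOp U k) := by
    rw [← mul_assoc, geom_sum_mul, sub_mul, one_mul]
  rw [h1]
  refine (norm_amp_mul_le w _ _).trans ?_
  have h2 : ‖∑ i ∈ Finset.range j, u ^ i‖ ≤ j := by
    refine (norm_sum_le _ _).trans
      ((Finset.sum_le_card_nsmul _ _ 1 fun i _ => h.norm_phase_pow_le k i).trans ?_)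
    simp
  have h3 : (j : ℝ) ≤ N := by exact_mod_cast hj.le
  have hN := h.one_le_cast
  calc _ ≤ (N : ℝ) * (ζ / N) :=
        mul_le_mul (h2.trans h3) (h.norm_amp_phase_sub_one k) (norm_nonneg _) (by positivity)
    _ = ζ := by field_simp

theorem norm_amp_star_pow_sub (h : NearlyCyclic N w U M₀ η ζ) (k : Fin N) {j : ℕ} (hj : j < N) :
    ‖amp w (star ((unityRoot N ^ (k : ℕ) • U) ^ j) * levelOp U k - levelOp U k)‖ ≤ ζ := by
  set u := unityRoot N ^ (k : ℕ) • U with hu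
  have h1 : star (u ^ j) * levelOp U k - levelOp U k =
      -(star (u ^ j) * (u ^ j * levelOp U k - levelOp U k)) := by
    rw [mul_sub, ← mul_assoc, h.star_pow_mul_pow, one_mul, neg_sub]
  rw [h1, map_neg, norm_neg]
  refine (norm_amp_mul_le_of_norm_le_one w ?_ _).trans (h.norm_amp_pow_sub k hj)
  rw [norm_star]
  exact h.norm_phase_pow_le _ _

theorem phase_pow_eq (h : NearlyCyclic N w U M₀ η ζ) (l k : Fin N) (j : ℕ) :
    (unityRoot N ^ (l : ℕ) • U) ^ j =
      (unityRoot N ^ (l : ℕ) * (unityRoot N ^ (k : ℕ))⁻¹) ^ j •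
        (unityRoot N ^ (k : ℕ) • U) ^ j := by
  rw [← smul_pow, smul_smul, mul_assoc,
    inv_mul_cancel₀ (pow_ne_zero _ (unityRoot_ne_zero h.ne_zero)), mul_one]

theorem norm_phase_ratio (h : NearlyCyclic N w U M₀ η ζ) (l k : Fin N) (j : ℕ) :
    ‖(unityRoot N ^ (l : ℕ) * (unityRoot N ^ (k : ℕ))⁻¹) ^ j‖ ≤ 1 := by
  simp [norm_unityRoot h.ne_zero]

/-- On `P_k w` the powers of `ω^k U` act almost trivially, so `P_l` acts there as an average of the
characters `ω^{(l-k)j}`. -/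
theorem norm_amp_levelOp_mul_levelOp (h : NearlyCyclic N w U M₀ η ζ) (l k : Fin N) :
    ‖amp w (levelOp U l * levelOp U k - (if l = k then (1 : ℂ) else 0) • levelOp U k)‖ ≤ ζ := by
  rw [← average_unityRoot_pow l k]
  have h1 : levelOp U l * levelOp U k - ((N : ℂ)⁻¹ * ∑ j ∈ Finset.range N,
      (unityRoot N ^ (l : ℕ) * (unityRoot N ^ (k : ℕ))⁻¹) ^ j) • levelOp U k =
      (N : ℂ)⁻¹ • ∑ j ∈ Finset.range N,
        (unityRoot N ^ (l : ℕ) * (unityRoot N ^ (k : ℕ))⁻¹) ^ j •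
          ((unityRoot N ^ (k : ℕ) • U) ^ j * levelOp U k - levelOp U k) := by
    conv_lhs => enter [1, 1]; rw [levelOp]
    simp_rw [h.phase_pow_eq l k]
    rw [smul_mul_assoc, mul_smul, ← smul_sub, Finset.sum_mul, Finset.sum_smul,
      ← Finset.sum_sub_distrib]
    simp_rw [smul_sub, smul_mul_assoc]
  rw [h1]
  exact norm_amp_average_le w (h.norm_phase_ratio l k) h.zeta_nonneg
    fun j hj => h.norm_amp_pow_sub k hj

theorem norm_amp_star_levelOp_mul_levelOp (h : NearlyCyclic N w U M₀ η ζ) (l k : Fin N) :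
    ‖amp w (star (levelOp U l) * levelOp U k
      - (if l = k then (1 : ℂ) else 0) • levelOp U k)‖ ≤ ζ := by
  have h0 : (if l = k then (1 : ℂ) else 0) = star (if l = k then (1 : ℂ) else 0) := by
    split_ifs <;> simp
  rw [h0, ← average_unityRoot_pow l k]
  have h1 : star (levelOp U l) * levelOp U k - star ((N : ℂ)⁻¹ * ∑ j ∈ Finset.range N,
      (unityRoot N ^ (l : ℕ) * (unityRoot N ^ (k : ℕ))⁻¹) ^ j) • levelOp U k =
      (N : ℂ)⁻¹ • ∑ j ∈ Finset.range N,
        star ((unityRoot N ^ (l : ℕ) * (unityRoot N ^ (k : ℕ))⁻¹) ^ j) •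
          (star ((unityRoot N ^ (k : ℕ) • U) ^ j) * levelOp U k - levelOp U k) := by
    conv_lhs => enter [1, 1]; rw [levelOp]
    simp_rw [h.phase_pow_eq l k]
    rw [star_smul, star_sum, star_mul', star_sum, smul_mul_assoc, mul_smul]
    simp_rw [star_smul]
    rw [star_inv₀, star_natCast, ← smul_sub, Finset.sum_mul, Finset.sum_smul,
      ← Finset.sum_sub_distrib]
    simp_rw [smul_sub, smul_mul_assoc]
  rw [h1]
  refine norm_amp_average_le w (fun j => ?_) h.zeta_nonneg
    fun j hj => h.norm_amp_star_pow_sub k hj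
  rw [norm_star]
  exact h.norm_phase_ratio l k j

theorem sum_levelOp (h : NearlyCyclic N w U M₀ η ζ) : ∑ k : Fin N, levelOp U k = 1 := by
  have hN := h.ne_zero
  have hN' : 0 < N := Nat.pos_of_ne_zero hN
  unfold levelOp
  rw [← Finset.smul_sum, Finset.sum_comm]
  simp_rw [smul_pow, ← Finset.sum_smul]
  have h1 : ∀ j ∈ Finset.range N, (∑ k : Fin N, (unityRoot N ^ (k : ℕ)) ^ j) • U ^ j =
      if j = 0 then (N : ℂ) • (1 : E →L[ℂ] E) else 0 := by
    intro j hj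
    have h2 := average_unityRoot_pow (N := N) ⟨j, Finset.mem_range.1 hj⟩ ⟨0, hN'⟩
    have h3 : ∑ k : Fin N, (unityRoot N ^ (k : ℕ)) ^ j =
        (N : ℂ) * if (⟨j, Finset.mem_range.1 hj⟩ : Fin N) = ⟨0, hN'⟩ then 1 else 0 := by
      rw [← h2, mul_inv_cancel_left₀ (by exact_mod_cast hN), Finset.sum_range]
      refine Finset.sum_congr rfl fun k _ => ?_
      rw [pow_zero, inv_one, mul_one, ← pow_mul, ← pow_mul, mul_comm]
    rw [h3]
    by_cases hj0 : j = 0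
    · simp [hj0]
    · simp [hj0]
  rw [Finset.sum_congr rfl h1, Finset.sum_ite_eq' _ 0, if_pos (Finset.mem_range.2 hN'),
    inv_smul_smul₀ (by exact_mod_cast hN)]

theorem norm_levelOp_le (h : NearlyCyclic N w U M₀ η ζ) (k : Fin N) : ‖levelOp U k‖ ≤ 1 := by
  have hN := h.one_le_cast
  rw [levelOp, norm_smul, norm_inv, Complex.norm_natCast, inv_mul_le_iff₀ (by positivity)]
  refine (norm_sum_le _ _).trans
    ((Finset.sum_le_card_nsmul _ _ 1 fun i _ => h.norm_phase_pow_le k i).trans ?_)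
  simp

/-- Both `P_k†` and `P_k` act on each `P_l w` almost as `δ_{kl}`, and the `P_l` sum to one. Only
that `U` is an isometry enters. -/
theorem norm_amp_star_levelOp_sub (h : NearlyCyclic N w U M₀ η ζ) (k : Fin N) :
    ‖amp w (star (levelOp U k) - levelOp U k)‖ ≤ 2 * N * ζ := by
  have h1 : star (levelOp U k) - levelOp U k = ∑ l : Fin N,
      ((star (levelOp U k) * levelOp U l - (if k = l then (1 : ℂ) else 0) • levelOp U l)
        - (levelOp U k * levelOp U l - (if k = l then (1 : ℂ) else 0) • levelOp U l)) := by
    simp_rw [sub_sub_sub_cancel_right]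
    rw [Finset.sum_sub_distrib, ← Finset.mul_sum, ← Finset.mul_sum, h.sum_levelOp, mul_one,
      mul_one]
  rw [h1, map_sum]
  refine (norm_sum_le _ _).trans ((Finset.sum_le_card_nsmul _ _ (2 * ζ) fun l _ => ?_).trans ?_)
  · rw [map_sub, two_mul]
    exact (norm_sub_le _ _).trans
      (add_le_add (h.norm_amp_star_levelOp_mul_levelOp k l) (h.norm_amp_levelOp_mul_levelOp k l))
  · simp only [Finset.card_univ, Fintype.card_fin, nsmul_eq_mul]
    linarith

/-- In the Fourier sum `M₀` nearly fixes the term `j = 0` and nearly kills all the others. -/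
theorem norm_amp_meas_levelOp_sub (h : NearlyCyclic N w U M₀ η ζ) (k : Fin N) :
    ‖amp w (M₀ * levelOp U k - (N : ℂ)⁻¹ • 1)‖ ≤ η := by
  have hN' : 0 < N := Nat.pos_of_ne_zero h.ne_zero
  have h1 : M₀ * levelOp U k - (N : ℂ)⁻¹ • 1 = (N : ℂ)⁻¹ • ∑ j ∈ Finset.range N,
      (unityRoot N ^ (k : ℕ)) ^ j • (M₀ * U ^ j - if j = 0 then 1 else 0) := by
    simp_rw [levelOp, smul_sub, Finset.sum_sub_distrib, smul_sub, mul_smul_comm, Finset.mul_sum,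
      smul_pow, mul_smul_comm]
    congr 2
    simp [hN'.ne']
  rw [h1]
  refine norm_amp_average_le w (fun j => (h.norm_phase_pow _ _).le) h.eta_nonneg fun j hj => ?_
  rcases Nat.eq_zero_or_pos j with rfl | hj0
  · rw [pow_zero, mul_one, if_pos rfl, ← neg_sub, map_neg, norm_neg]
    exact h.norm_one_sub
  · rw [if_neg hj0.ne', sub_zero]
    exact h.norm_mul_pow j hj0 hj

end NearlyCyclic

end Levels

/-! ### Completing a tuple of operators to an exact isometry -/

section Dilation

variable {E : Type*} [NormedAddCommGroup E] [InnerProductSpace ℂ E] [CompleteSpace E] {N : ℕ}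

/-- The operator `∑ₗ Aₗ† Aₗ`. -/
def gram (A : Fin N → E →L[ℂ] E) : E →L[ℂ] E := ∑ l, star (A l) * A l

/-- The operator `(1 + ∑ₗ Aₗ† Aₗ)⁻¹`. -/
def gramResolvent (A : Fin N → E →L[ℂ] E) : E →L[ℂ] E := Ring.inverse (1 + gram A)

/-- The defect operator `(1 - B) (1 + B)⁻¹ = 2 (1 + B)⁻¹ - 1` with `B = ∑ₗ Aₗ† Aₗ`. -/
def gramDefect (A : Fin N → E →L[ℂ] E) : E →L[ℂ] E := (2 : ℂ) • gramResolvent A - 1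

/-- The components `2 Aₗ (1 + B)⁻¹` of a contraction. -/
def gramContraction (A : Fin N → E →L[ℂ] E) (l : Fin N) : E →L[ℂ] E :=
  (2 : ℂ) • (A l * gramResolvent A)

variable (A : Fin N → E →L[ℂ] E)

theorem gram_nonneg : 0 ≤ gram A := Finset.sum_nonneg fun l _ => star_mul_self_nonneg (A l)

theorem isUnit_one_add_gram : IsUnit (1 + gram A) :=
  CStarAlgebra.isUnit_of_le _ (le_add_of_nonneg_right (gram_nonneg A)) isStrictlyPositive_one

theorem one_add_gram_mul_gramResolvent : (1 + gram A) * gramResolvent A = 1 :=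
  Ring.mul_inverse_cancel _ (isUnit_one_add_gram A)

theorem gramResolvent_mul_one_add_gram : gramResolvent A * (1 + gram A) = 1 :=
  Ring.inverse_mul_cancel _ (isUnit_one_add_gram A)

theorem star_gramResolvent : star (gramResolvent A) = gramResolvent A := by
  have h1 : star (gram A) = gram A := (gram_nonneg A).isSelfAdjoint
  have h2 := congrArg star (one_add_gram_mul_gramResolvent A)
  rw [star_mul, star_add, star_one, h1] at h2
  calc star (gramResolvent A)
      = star (gramResolvent A) * ((1 + gram A) * gramResolvent A) := by
        rw [one_add_gram_mul_gramResolvent, mul_one]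
    _ = gramResolvent A := by rw [← mul_assoc, h2, one_mul]

theorem star_gramDefect : star (gramDefect A) = gramDefect A := by
  rw [gramDefect, star_sub, star_smul, star_gramResolvent, star_one]
  simp

theorem gramDefect_eq : gramDefect A = gramResolvent A * (1 - gram A) := by
  have h := gramResolvent_mul_one_add_gram A
  rw [mul_add, mul_one] at h
  rw [gramDefect, mul_sub, mul_one, two_smul, ← h]
  abel

/-- Shows that the correction made to `A l` is controlled by the defect alone. -/
theorem gramContraction_eq (l : Fin N) :
    gramContraction A l = A l + A l * gramDefect A := by
  rw [gramContraction, gramDefect, mul_sub, mul_one, mul_smul_comm, add_sub_cancel]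

/-- With `R = (1 + B)⁻¹` this is `4 R B R + (2R - 1)² = 1`, which follows from `R B = 1 - R`. -/
theorem sum_star_gramContraction_mul :
    ∑ l, star (gramContraction A l) * gramContraction A l + star (gramDefect A) * gramDefect A
      = 1 := by
  have h1 : ∑ l, star (gramContraction A l) * gramContraction A l =
      (4 : ℂ) • (gramResolvent A * gram A * gramResolvent A) := by
    unfold gramContraction
    rw [gram, Finset.mul_sum, Finset.sum_mul, Finset.smul_sum]
    refine Finset.sum_congr rfl fun l _ => ?_
    rw [star_smul, star_mul, star_gramResolvent, smul_mul_smul_comm]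
    simp only [mul_assoc]
    congr 1
    simp
    norm_num
  have h2 : gramResolvent A * gram A = 1 - gramResolvent A := by
    rw [← gramResolvent_mul_one_add_gram A]
    noncomm_ring
  rw [h1, h2, star_gramDefect, gramDefect]
  simp only [sub_mul, mul_sub, one_mul, mul_one, smul_mul_assoc, mul_smul_comm, smul_sub, smul_smul]
  module

theorem norm_apply_sq_eq_re_inner {F : Type*} [NormedAddCommGroup F] [InnerProductSpace ℂ F]
    [CompleteSpace F] (X : E →L[ℂ] F) (x : E) : ‖X x‖ ^ 2 = (⟪x, (adjoint X ∘L X) x⟫_ℂ).re := by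
  rw [comp_apply, adjoint_inner_right]
  exact (inner_self_eq_norm_sq (𝕜 := ℂ) (X x)).symm

theorem sum_norm_gramContraction_sq (x : E) :
    ∑ l, ‖gramContraction A l x‖ ^ 2 + ‖gramDefect A x‖ ^ 2 = ‖x‖ ^ 2 := by
  have h := congrArg (fun X : E →L[ℂ] E => (⟪x, X x⟫_ℂ).re) (sum_star_gramContraction_mul A)
  simp only [add_apply, sum_apply, inner_add_right, inner_sum, Complex.add_re, Complex.re_sum] at h
  simp_rw [norm_apply_sq_eq_re_inner]
  refine h.trans ?_
  exact inner_self_eq_norm_sq (𝕜 := ℂ) x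

theorem norm_gramDefect_le : ‖gramDefect A‖ ≤ 1 := by
  refine opNorm_le_bound _ zero_le_one fun x => ?_
  rw [one_mul]
  refine le_of_sq_le_sq ?_ (norm_nonneg _)
  rw [← sum_norm_gramContraction_sq A x]
  exact le_add_of_nonneg_left (Finset.sum_nonneg fun _ _ => by positivity)

theorem norm_gramResolvent_le : ‖gramResolvent A‖ ≤ 1 := by
  have h : gramResolvent A = (2⁻¹ : ℂ) • (1 + gramDefect A) := by
    rw [gramDefect, add_sub_cancel, smul_smul]
    simp
  have h1 : ‖(1 : E →L[ℂ] E)‖ ≤ 1 := norm_id_le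
  have h2 := norm_gramDefect_le A
  rw [h, norm_smul, norm_inv, Complex.norm_ofNat]
  have := norm_add_le (1 : E →L[ℂ] E) (gramDefect A)
  linarith

/-! ### The isometry into `ℂ^N ⊗ (E ⊕ E)` -/

/-- The embedding of `E` as the first summand of `E ⊕ E`. -/
def inlL : E →L[ℂ] WithLp 2 (E × E) :=
  LinearMap.mkContinuous
    { toFun := fun x => WithLp.toLp 2 (x, 0)
      map_add' := fun x y => by rw [← WithLp.toLp_add]; simp
      map_smul' := fun c x => by rw [← WithLp.toLp_smul]; simp } 1 fun x => by
    simp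

/-- The embedding of `E` as the second summand of `E ⊕ E`. -/
def inrL : E →L[ℂ] WithLp 2 (E × E) :=
  LinearMap.mkContinuous
    { toFun := fun x => WithLp.toLp 2 (0, x)
      map_add' := fun x y => by rw [← WithLp.toLp_add]; simp
      map_smul' := fun c x => by rw [← WithLp.toLp_smul]; simp } 1 fun x => by
    simp

theorem inlL_apply (x : E) : inlL x = WithLp.toLp 2 (x, 0) := rfl

theorem inrL_apply (x : E) : inrL x = WithLp.toLp 2 (0, x) := rfl

theorem norm_inlL_apply (x : E) : ‖inlL x‖ = ‖x‖ := by simp [inlL_apply]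

theorem norm_inrL_apply (x : E) : ‖inrL x‖ = ‖x‖ := by simp [inrL_apply]

variable {K : Type*} [NormedAddCommGroup K] [InnerProductSpace ℂ K]

/-- The map `x ↦ v ⊗ x`. -/
def tmulL (v : EuclideanSpace ℂ (Fin N)) : K →L[ℂ] EuclideanSpace ℂ (Fin N) ⊗[ℂ] K :=
  LinearMap.mkContinuous (TensorProduct.mk ℂ _ K v) ‖v‖ fun x => by
    simp

theorem tmulL_apply (v : EuclideanSpace ℂ (Fin N)) (x : K) : tmulL v x = v ⊗ₜ[ℂ] x := rfl

theorem norm_tmulL_apply (v : EuclideanSpace ℂ (Fin N)) (x : K) : ‖tmulL v x‖ = ‖v‖ * ‖x‖ := by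
  simp [tmulL_apply]

theorem tmulL_sub (v v' : EuclideanSpace ℂ (Fin N)) :
    (tmulL (v - v') : K →L[ℂ] _) = tmulL v - tmulL v' := by
  ext x; simp [tmulL_apply, TensorProduct.sub_tmul]

theorem tmulL_smul (c : ℂ) (v : EuclideanSpace ℂ (Fin N)) :
    (tmulL (c • v) : K →L[ℂ] _) = c • tmulL v := by
  ext x; simp [tmulL_apply, TensorProduct.smul_tmul']

theorem tmulL_sum {α : Type*} (s : Finset α) (v : α → EuclideanSpace ℂ (Fin N)) :
    (tmulL (∑ i ∈ s, v i) : K →L[ℂ] _) = ∑ i ∈ s, tmulL (v i) := by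
  ext x; simp [tmulL_apply, TensorProduct.sum_tmul]

/-- The map `x ↦ v ⊗ (x, 0)`. -/
def embL (v : EuclideanSpace ℂ (Fin N)) :
    E →L[ℂ] EuclideanSpace ℂ (Fin N) ⊗[ℂ] WithLp 2 (E × E) := tmulL v ∘L inlL

/-- The dilation `x ↦ ∑ₗ |l⟩ ⊗ (Tₗ x, 0) + |i₀⟩ ⊗ (0, D x)`. -/
def dilation (i₀ : Fin N) : E →L[ℂ] EuclideanSpace ℂ (Fin N) ⊗[ℂ] WithLp 2 (E × E) :=
  ∑ l, embL (EuclideanSpace.single l 1) ∘L gramContraction A l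
    + tmulL (EuclideanSpace.single i₀ 1) ∘L inrL ∘L gramDefect A

theorem norm_dilation_apply (i₀ : Fin N) (x : E) : ‖dilation A i₀ x‖ = ‖x‖ := by
  -- The image of `x` read in `K^N`. The defect lies in the second summand of `E ⊕ E`, orthogonal to
  -- all the other components, so the slot `i₀` that holds it is immaterial.
  set f : PiLp 2 (fun _ : Fin N => WithLp 2 (E × E)) := WithLp.toLp 2 fun l =>
    WithLp.toLp 2 (gramContraction A l x, if l = i₀ then gramDefect A x else 0) with hf
  have h1 : dilation A i₀ x = sumTmul N (WithLp 2 (E × E)) f := by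
    have h2 : ∀ l, f l = inlL (gramContraction A l x) +
        if l = i₀ then inrL (gramDefect A x) else 0 := by
      intro l
      rw [hf]
      split_ifs with h
      · simp only [inlL_apply, inrL_apply, h, if_true]
        rw [← WithLp.toLp_add]
        simp
      · simp [inlL_apply, h]
    simp only [sumTmul, LinearMap.coe_mk, AddHom.coe_mk, h2, TensorProduct.tmul_add,
      Finset.sum_add_distrib]
    simp [dilation, embL, tmulL_apply, sum_apply, TensorProduct.tmul_ite]
  have h3 : ‖sumTmul N (WithLp 2 (E × E)) f‖ = ‖f‖ := by
    rw [@norm_eq_sqrt_re_inner ℂ, inner_sumTmul, ← @norm_eq_sqrt_re_inner ℂ]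
  rw [h1, h3]
  refine (sq_eq_sq₀ (norm_nonneg _) (norm_nonneg _)).1 ?_
  rw [PiLp.norm_sq_eq_of_L2, ← sum_norm_gramContraction_sq A x]
  simp only [hf, WithLp.prod_norm_sq_eq_of_L2, Finset.sum_add_distrib]
  congr 1
  rw [Finset.sum_eq_single i₀]
  · simp
  · intro l _ hl
    simp [hl]
  · simp

end Dilation

/-! ### Action of the dilation on the approximate levels -/

section DilationEstimates

variable {ι E : Type*} [NormedAddCommGroup E] [InnerProductSpace ℂ E] [CompleteSpace E]
  {N : ℕ}

theorem norm_embL_le (v : EuclideanSpace ℂ (Fin N)) :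
    ‖(embL v : E →L[ℂ] EuclideanSpace ℂ (Fin N) ⊗[ℂ] WithLp 2 (E × E))‖ ≤ ‖v‖ :=
  opNorm_le_bound _ (norm_nonneg _) fun x => by
    rw [embL, comp_apply, norm_tmulL_apply, norm_inlL_apply]

theorem norm_dilation_le (A : Fin N → E →L[ℂ] E) (i₀ : Fin N) : ‖dilation A i₀‖ ≤ 1 :=
  opNorm_le_bound _ zero_le_one fun x => by rw [norm_dilation_apply, one_mul]

/-- The operators `√N M₀ Pₗ`, where `Pₗ` are the approximate level projections of `U`. -/
def measLevel (U M₀ : E →L[ℂ] E) (l : Fin N) : E →L[ℂ] E :=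
  ((√N : ℝ) : ℂ) • (M₀ * levelOp U l)

namespace NearlyCyclic

variable {w : lp (fun _ : ι => E) 2} {U M₀ : E →L[ℂ] E} {η ζ : ℝ}

theorem sqrt_le_cast (h : NearlyCyclic N w U M₀ η ζ) : √(N : ℝ) ≤ N := by
  rw [Real.sqrt_le_left (by positivity)]
  nlinarith [h.one_le_cast]

theorem norm_measLevel_le (h : NearlyCyclic N w U M₀ η ζ)
    (l : Fin N) : ‖measLevel U M₀ l‖ ≤ √N := by
  rw [measLevel, norm_smul, Complex.norm_real, Real.norm_eq_abs, abs_of_nonneg (by positivity)]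
  refine mul_le_of_le_one_right (by positivity) ((norm_mul_le _ _).trans ?_)
  exact mul_le_one₀ h.norm_le (norm_nonneg _) (h.norm_levelOp_le l)

/-- Combines `P_l P_k w ≈ δ_{lk} P_k w` with `M₀ P_k w ≈ w / N`; the factor `√N` turns `1 / N` into
the amplitude `1 / √N` of the reference vector. -/
theorem norm_amp_measLevel_mul_sub (h : NearlyCyclic N w U M₀ η ζ) (l k : Fin N) :
    ‖amp w (measLevel U M₀ l * levelOp U k
      - (if l = k then (((√N)⁻¹ : ℝ) : ℂ) else 0) • 1)‖ ≤ √N * (ζ + η) := by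
  have hN := h.one_le_cast
  set s : ℂ := ((√N : ℝ) : ℂ) with hs
  have hss : s * (N : ℂ)⁻¹ = (((√N)⁻¹ : ℝ) : ℂ) := by
    rw [hs, ← Complex.ofReal_natCast, ← Complex.ofReal_inv, ← Complex.ofReal_mul,
      ← div_eq_mul_inv, Real.sqrt_div_self]
  have h1 : measLevel U M₀ l * levelOp U k - (if l = k then (((√N)⁻¹ : ℝ) : ℂ) else 0) • 1 =
      s • (M₀ * (levelOp U l * levelOp U k - (if l = k then (1 : ℂ) else 0) • levelOp U k)
        + (if l = k then (1 : ℂ) else 0) • (M₀ * levelOp U k - (N : ℂ)⁻¹ • 1)) := by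
    rw [← hss, measLevel]
    split_ifs with hlk
    · rw [one_smul, one_smul, mul_sub, sub_add_sub_cancel, smul_sub, smul_smul, smul_mul_assoc,
        mul_assoc]
    · rw [zero_smul, zero_smul, zero_smul, sub_zero, sub_zero, add_zero, smul_mul_assoc, mul_assoc]
  rw [h1, map_smul, norm_smul, hs, Complex.norm_real, Real.norm_eq_abs,
    abs_of_nonneg (by positivity), map_add]
  gcongr
  refine (norm_add_le _ _).trans (add_le_add ?_ ?_)
  · exact (norm_amp_mul_le_of_norm_le_one w h.norm_le _).trans (h.norm_amp_levelOp_mul_levelOp l k)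
  · rw [map_smul, norm_smul]
    refine (mul_le_of_le_one_left (norm_nonneg _) ?_).trans (h.norm_amp_meas_levelOp_sub k)
    split_ifs <;> simp

/-- The chain is `B P_k w ≈ A_k† w / √N = P_k† M₀ w ≈ P_k† w ≈ P_k w`, with errors at most `N² (ζ +
η)`, `η` and `2 N ζ`. -/
theorem norm_amp_gram_mul_sub (h : NearlyCyclic N w U M₀ η ζ) (k : Fin N) :
    ‖amp w ((1 - gram (measLevel (N := N) U M₀)) * levelOp U k)‖ ≤ 4 * N ^ 2 * (ζ + η) := by
  have hN := h.one_le_cast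
  have hη := h.eta_nonneg
  have hζ := h.zeta_nonneg
  set A : Fin N → E →L[ℂ] E := measLevel U M₀ with hA
  have hc : star ((((√N)⁻¹ : ℝ) : ℂ)) • star (A k) = star (levelOp U k) * M₀ := by
    rw [hA, measLevel, star_smul, star_mul, h.isSelfAdjoint.star_eq, smul_smul, ← star_mul',
      ← Complex.ofReal_mul, inv_mul_cancel₀ (by positivity : √(N : ℝ) ≠ 0)]
    simp
  have h1 : (1 - gram A) * levelOp U k =
      star (levelOp U k) * (1 - M₀) - (star (levelOp U k) - levelOp U k)
      - ∑ l, star (A l) * (A l * levelOp U k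
          - (if l = k then (((√N)⁻¹ : ℝ) : ℂ) else 0) • 1) := by
    have h2 : ∑ l, star (A l) * (A l * levelOp U k
          - (if l = k then (((√N)⁻¹ : ℝ) : ℂ) else 0) • 1) =
        gram A * levelOp U k - star (levelOp U k) * M₀ := by
      simp_rw [mul_sub, Finset.sum_sub_distrib, gram, Finset.sum_mul, mul_assoc]
      congr 1
      rw [Finset.sum_eq_single k]
      · rw [← hc, if_pos rfl, mul_smul_comm, mul_one]
        simp
      · intro l _ hl
        rw [if_neg hl, zero_smul, mul_zero]
      · simp
    rw [h2]
    noncomm_ring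
  have h3 : ∀ l, ‖amp w (star (A l) * (A l * levelOp U k
          - (if l = k then (((√N)⁻¹ : ℝ) : ℂ) else 0) • 1))‖ ≤ N * (ζ + η) := by
    intro l
    refine (norm_amp_mul_le w _ _).trans ?_
    rw [norm_star]
    calc _ ≤ √N * (√N * (ζ + η)) := mul_le_mul (h.norm_measLevel_le l)
          (h.norm_amp_measLevel_mul_sub l k) (norm_nonneg _) (by positivity)
      _ = N * (ζ + η) := by rw [← mul_assoc, Real.mul_self_sqrt (by positivity)]
  have h4 : ‖amp w (star (levelOp U k) * (1 - M₀))‖ ≤ η := by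
    refine (norm_amp_mul_le_of_norm_le_one w ?_ _).trans h.norm_one_sub
    rw [norm_star]
    exact h.norm_levelOp_le k
  rw [h1, map_sub, map_sub, map_sum]
  have h5 := (norm_sum_le _ _).trans
    (Finset.sum_le_card_nsmul Finset.univ _ _ fun l _ => h3 l)
  rw [Finset.card_univ, Fintype.card_fin, nsmul_eq_mul] at h5
  have h6 := norm_sub_le (amp w (star (levelOp U k) * (1 - M₀)))
    (amp w (star (levelOp U k) - levelOp U k))
  refine (norm_sub_le _ _).trans ?_
  have h7 := h.norm_amp_star_levelOp_sub k
  nlinarith [mul_nonneg (sub_nonneg.2 hN) hζ, mul_nonneg (sub_nonneg.2 hN) hη,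
    mul_nonneg (sq_nonneg ((N : ℝ) - 1)) hζ, mul_nonneg (sq_nonneg ((N : ℝ) - 1)) hη]

theorem norm_amp_gramDefect_mul (h : NearlyCyclic N w U M₀ η ζ) (k : Fin N) :
    ‖amp w (gramDefect (measLevel (N := N) U M₀) * levelOp U k)‖ ≤ 4 * N ^ 2 * (ζ + η) := by
  rw [gramDefect_eq, mul_assoc]
  exact (norm_amp_mul_le_of_norm_le_one w (norm_gramResolvent_le _) _).trans
    (h.norm_amp_gram_mul_sub k)

theorem norm_amp_gramContraction_mul_sub (h : NearlyCyclic N w U M₀ η ζ) (l k : Fin N) :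
    ‖amp w (gramContraction (measLevel U M₀) l * levelOp U k
      - (if l = k then (((√N)⁻¹ : ℝ) : ℂ) else 0) • 1)‖ ≤ 5 * N ^ 3 * (ζ + η) := by
  have hN := h.one_le_cast
  have hε : 0 ≤ ζ + η := add_nonneg h.zeta_nonneg h.eta_nonneg
  rw [gramContraction_eq, add_mul, add_sub_right_comm, map_add, mul_assoc]
  refine (norm_add_le _ _).trans ?_
  have h1 := h.norm_amp_measLevel_mul_sub l k
  have h2 : ‖amp w (measLevel U M₀ l * (gramDefect (measLevel (N := N) U M₀) * levelOp U k))‖ ≤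
      N * (4 * N ^ 2 * (ζ + η)) := (norm_amp_mul_le w _ _).trans
    (mul_le_mul ((h.norm_measLevel_le l).trans h.sqrt_le_cast) (h.norm_amp_gramDefect_mul k)
      (norm_nonneg _) (by positivity))
  have h3 : √(N : ℝ) * (ζ + η) ≤ N ^ 3 * (ζ + η) := by
    gcongr
    exact h.sqrt_le_cast.trans (le_self_pow₀ hN (by norm_num))
  linarith

theorem norm_amp_dilation_levelOp_sub (h : NearlyCyclic N w U M₀ η ζ) (i₀ k : Fin N) :
    ‖amp w (dilation (measLevel U M₀) i₀ ∘L levelOp U k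
      - (((√N)⁻¹ : ℝ) : ℂ) • embL (EuclideanSpace.single k 1))‖ ≤ 9 * N ^ 4 * (ζ + η) := by
  have hN := h.one_le_cast
  have hε : 0 ≤ ζ + η := add_nonneg h.zeta_nonneg h.eta_nonneg
  set A : Fin N → E →L[ℂ] E := measLevel U M₀ with hA
  have h1 : dilation A i₀ ∘L levelOp U k - (((√N)⁻¹ : ℝ) : ℂ) • embL (EuclideanSpace.single k 1) =
      ∑ l, embL (E := E) (EuclideanSpace.single l 1) ∘L (gramContraction A l * levelOp U k
          - (if l = k then (((√N)⁻¹ : ℝ) : ℂ) else 0) • 1)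
      + (tmulL (EuclideanSpace.single i₀ 1) ∘L inrL) ∘L (gramDefect A * levelOp U k) := by
    ext x
    have h0 : ∑ l : Fin N, embL (EuclideanSpace.single l (1 : ℂ))
        ((if l = k then (((√N)⁻¹ : ℝ) : ℂ) else 0) • (1 : E →L[ℂ] E) x) =
        (((√N)⁻¹ : ℝ) : ℂ) • embL (EuclideanSpace.single k 1) x := by
      rw [Finset.sum_eq_single k]
      · rw [if_pos rfl, map_smul, one_apply_eq_self]
      · intro l _ hl
        rw [if_neg hl, zero_smul, map_zero]
      · simp
    simp only [dilation, sub_apply, add_apply, sum_apply, comp_apply, smul_apply, map_sub,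
      mul_apply_eq_comp, Finset.sum_sub_distrib, h0]
    abel
  have h2 : ∀ l, ‖amp w (embL (E := E) (EuclideanSpace.single l (1 : ℂ)) ∘L
      (gramContraction A l * levelOp U k
          - (if l = k then (((√N)⁻¹ : ℝ) : ℂ) else 0) • 1))‖ ≤ 5 * N ^ 3 * (ζ + η) := by
    intro l
    refine (norm_amp_comp_le w _ _).trans ((mul_le_of_le_one_left (norm_nonneg _) ?_).trans
      (h.norm_amp_gramContraction_mul_sub l k))
    exact (norm_embL_le _).trans (by simp)
  have h3 : ‖amp w ((tmulL (EuclideanSpace.single i₀ (1 : ℂ)) ∘L inrL) ∘L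
      (gramDefect A * levelOp U k))‖ ≤ 4 * N ^ 2 * (ζ + η) := by
    refine (norm_amp_mono w (Y := gramDefect A * levelOp U k) fun x => ?_).trans
      (h.norm_amp_gramDefect_mul k)
    rw [comp_apply, comp_apply, norm_tmulL_apply, norm_inrL_apply]
    simp
  rw [h1, map_add, map_sum]
  refine (norm_add_le _ _).trans ?_
  have h5 := (norm_sum_le _ _).trans
    (Finset.sum_le_card_nsmul Finset.univ _ _ fun l _ => h2 l)
  rw [Finset.card_univ, Fintype.card_fin, nsmul_eq_mul] at h5
  have h6 : 4 * (N : ℝ) ^ 2 * (ζ + η) ≤ 4 * N ^ 4 * (ζ + η) := by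
    gcongr 4 * ?_ * (ζ + η)
    exact pow_le_pow_right₀ hN (by norm_num)
  calc _ ≤ N * (5 * N ^ 3 * (ζ + η)) + 4 * N ^ 4 * (ζ + η) := add_le_add h5 (h3.trans h6)
    _ = _ := by ring

/-- If the `k`-th approximate level is nearly an eigenvector of a contraction `S` with phase `c k`,
then the dilation nearly maps `S` to the diagonal operator with entries `c k`. -/
theorem norm_amp_dilation_comp_sub (h : NearlyCyclic N w U M₀ η ζ)
    (i₀ : Fin N) {S : E →L[ℂ] E} {c : Fin N → ℂ}
    (hc : ∀ k, ‖c k‖ ≤ 1) {τ : ℝ}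
    (hS : ∀ k, ‖amp w (S * levelOp U k - c k • levelOp U k)‖ ≤ τ) :
    ‖amp w (dilation (measLevel U M₀) i₀ ∘L S
      - embL (∑ k, (c k * (((√N)⁻¹ : ℝ) : ℂ)) • EuclideanSpace.single k 1))‖ ≤
      N * τ + 9 * N ^ 5 * (ζ + η) := by
  set V := dilation (measLevel U M₀) i₀ with hV
  have h1 : V ∘L S - embL (∑ k, (c k * (((√N)⁻¹ : ℝ) : ℂ)) • EuclideanSpace.single k 1) =
      ∑ k, (V ∘L (S * levelOp U k - c k • levelOp U k) + c k • (V ∘L levelOp U k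
        - (((√N)⁻¹ : ℝ) : ℂ) • embL (EuclideanSpace.single k 1))) := by
    -- Resolving the identity into levels reduces the claim to one level at a time.
    have h2 : S = ∑ k : Fin N, S * levelOp U k := by rw [← Finset.mul_sum, h.sum_levelOp, mul_one]
    conv_lhs => rw [h2]
    rw [embL, tmulL_sum]
    ext x
    simp only [sub_apply, sum_apply, comp_apply, map_sum, add_apply, smul_apply, map_sub,
      map_smul, smul_sub, smul_smul, tmulL_smul, embL, Finset.sum_add_distrib,
      Finset.sum_sub_distrib]
    abel
  rw [h1, map_sum]
  refine (norm_sum_le _ _).trans ((Finset.sum_le_card_nsmul _ _ (τ + 9 * N ^ 4 * (ζ + η))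
    fun k _ => ?_).trans ?_)
  · rw [map_add, map_smul]
    refine (norm_add_le _ _).trans (add_le_add ?_ ?_)
    · exact (norm_amp_comp_le w _ _).trans ((mul_le_of_le_one_left (norm_nonneg _)
        (norm_dilation_le _ _)).trans (hS k))
    · rw [norm_smul]
      exact (mul_le_of_le_one_left (norm_nonneg _) (hc k)).trans
        (h.norm_amp_dilation_levelOp_sub i₀ k)
  · simp only [Finset.card_univ, Fintype.card_fin, nsmul_eq_mul]
    apply le_of_eq
    ring

/-- Here `M₀ S w ≈ ∑ c_k M₀ P_k w ≈ (N⁻¹ ∑ c_k) w`, and the dilation sends `w` close to `ψ̄ ⊗ w`.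
The scalar is the overlap of `ψ̄` with the vector of amplitudes `c_k / √N`. -/
theorem norm_amp_dilation_meas_comp_sub (h : NearlyCyclic N w U M₀ η ζ)
    (i₀ : Fin N) {S : E →L[ℂ] E} {c : Fin N → ℂ}
    (hc : ∀ k, ‖c k‖ ≤ 1) {τ : ℝ}
    (hS : ∀ k, ‖amp w (S * levelOp U k - c k • levelOp U k)‖ ≤ τ) :
    ‖amp w (dilation (measLevel U M₀) i₀ ∘L (M₀ * S)
      - embL (((N : ℂ)⁻¹ * ∑ k, c k) •
          ∑ k : Fin N, (((√N)⁻¹ : ℝ) : ℂ) • EuclideanSpace.single k 1))‖ ≤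
      N * τ + 10 * N ^ 5 * (ζ + η) := by
  have hN := h.one_le_cast
  have hε : 0 ≤ ζ + η := add_nonneg h.zeta_nonneg h.eta_nonneg
  set V := dilation (measLevel U M₀) i₀ with hV
  set Θ : E →L[ℂ] EuclideanSpace ℂ (Fin N) ⊗[ℂ] WithLp 2 (E × E) :=
    embL (∑ k : Fin N, (((√N)⁻¹ : ℝ) : ℂ) • EuclideanSpace.single k 1) with hΘ
  have hVΘ : ‖amp w (V - Θ)‖ ≤ 9 * N ^ 5 * (ζ + η) := by
    -- The case of no evolution: `S = 1`, all phases `1`, no eigenvector error.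
    have := h.norm_amp_dilation_comp_sub i₀ (S := 1) (c := fun _ => 1) (by simp) (τ := 0)
      (by simp)
    simp only [one_mul, zero_add, mul_zero] at this
    exact this
  have h1 : V ∘L (M₀ * S) - embL (((N : ℂ)⁻¹ * ∑ k, c k) •
          ∑ k : Fin N, (((√N)⁻¹ : ℝ) : ℂ) • EuclideanSpace.single k 1) =
      V ∘L (∑ k, (M₀ * (S * levelOp U k - c k • levelOp U k)
        + c k • (M₀ * levelOp U k - (N : ℂ)⁻¹ • 1))) + ((N : ℂ)⁻¹ * ∑ k, c k) • (V - Θ) := by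
    have h2 : ∑ k, (M₀ * (S * levelOp U k - c k • levelOp U k)
        + c k • (M₀ * levelOp U k - (N : ℂ)⁻¹ • 1)) = M₀ * S - ((N : ℂ)⁻¹ * ∑ k, c k) • 1 := by
      have h3 : ∀ k, M₀ * (S * levelOp U k - c k • levelOp U k)
        + c k • (M₀ * levelOp U k - (N : ℂ)⁻¹ • 1) =
          M₀ * S * levelOp U k - ((N : ℂ)⁻¹ * c k) • 1 := by
        intro k
        rw [mul_sub, smul_sub, smul_smul, mul_smul_comm, sub_add_sub_cancel, mul_assoc,
          mul_comm (c k)]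
      rw [Finset.sum_congr rfl fun k _ => h3 k, Finset.sum_sub_distrib, ← Finset.mul_sum,
        h.sum_levelOp, mul_one, ← Finset.sum_smul, ← Finset.mul_sum]
    rw [h2, hΘ, embL, tmulL_smul]
    ext x
    simp only [sub_apply, comp_apply, add_apply, smul_apply, map_sub, map_smul, smul_sub, embL,
      one_apply_eq_self]
    abel
  have h4 : ‖(N : ℂ)⁻¹ * ∑ k, c k‖ ≤ 1 := by
    rw [norm_mul, norm_inv, Complex.norm_natCast, inv_mul_le_iff₀ (by positivity)]
    refine (norm_sum_le _ _).trans ((Finset.sum_le_card_nsmul _ _ 1 fun k _ => hc k).trans ?_)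
    simp
  have h5 : ‖amp w (∑ k, (M₀ * (S * levelOp U k - c k • levelOp U k)
        + c k • (M₀ * levelOp U k - (N : ℂ)⁻¹ • 1)))‖ ≤ N * (τ + η) := by
    rw [map_sum]
    refine (norm_sum_le _ _).trans ((Finset.sum_le_card_nsmul _ _ (τ + η) fun k _ => ?_).trans ?_)
    · rw [map_add, map_smul]
      refine (norm_add_le _ _).trans (add_le_add ?_ ?_)
      · exact (norm_amp_mul_le_of_norm_le_one w h.norm_le _).trans (hS k)
      · rw [norm_smul]
        exact (mul_le_of_le_one_left (norm_nonneg _) (hc k)).trans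
          (h.norm_amp_meas_levelOp_sub k)
    · simp only [Finset.card_univ, Fintype.card_fin, nsmul_eq_mul, le_refl]
  rw [h1, map_add, map_smul]
  refine (norm_add_le _ _).trans ?_
  have h6 := (norm_amp_comp_le w V (∑ k, (M₀ * (S * levelOp U k - c k • levelOp U k)
        + c k • (M₀ * levelOp U k - (N : ℂ)⁻¹ • 1)))).trans
        ((mul_le_of_le_one_left (norm_nonneg _) (norm_dilation_le _ _)).trans h5)
  have h7 : ‖((N : ℂ)⁻¹ * ∑ k, c k) • amp w (V - Θ)‖ ≤ 9 * N ^ 5 * (ζ + η) := by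
    rw [norm_smul]
    exact (mul_le_of_le_one_left (norm_nonneg _) h4).trans hVΘ
  have h8 : N * η ≤ N ^ 5 * (ζ + η) := by
    have := h.zeta_nonneg
    have := h.eta_nonneg
    gcongr
    · exact le_self_pow₀ hN (by norm_num)
    · linarith
  linarith

end NearlyCyclic

end DilationEstimates

/-! ### Time evolution under a Hamiltonian with spectrum in `[0, Λ]` -/

section Evolution

variable {ι E : Type*} [NormedAddCommGroup E] [InnerProductSpace ℂ E] [CompleteSpace E]
  {H : E →L[ℂ] E}

/-- The propagator `e^{-iHt}`. -/
def propagator (H : E →L[ℂ] E) (t : ℝ) : E →L[ℂ] E :=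
  NormedSpace.exp ((-(Complex.I * (t : ℂ))) • H)

theorem propagator_eq_cfc (hH : IsSelfAdjoint H) (t : ℝ) :
    propagator H t = cfc (fun z : ℂ => Complex.exp (-(Complex.I * (t : ℂ)) * z)) H :=
  exp_smul_eq_cfc hH _

theorem star_propagator (hH : IsSelfAdjoint H) (t : ℝ) :
    star (propagator H t) = NormedSpace.exp ((Complex.I * (t : ℂ)) • H) := by
  rw [propagator, NormedSpace.star_exp, star_smul, hH.star_eq]
  simp

theorem propagator_zero : propagator H 0 = 1 := by
  simp [propagator]

theorem propagator_mul (hH : IsSelfAdjoint H) (s t : ℝ) :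
    propagator H s * propagator H t = propagator H (s + t) := by
  have hn : IsStarNormal H := hH.isStarNormal
  rw [propagator_eq_cfc hH, propagator_eq_cfc hH, propagator_eq_cfc hH, ← cfc_mul _ _ H]
  congr 1
  funext z
  rw [← Complex.exp_add]
  push_cast
  congr 1
  ring

theorem star_propagator_eq (hH : IsSelfAdjoint H) (t : ℝ) :
    star (propagator H t) = propagator H (-t) := by
  rw [star_propagator hH, propagator]
  simp

theorem star_propagator_mul_self (hH : IsSelfAdjoint H) (t : ℝ) :
    star (propagator H t) * propagator H t = 1 := by
  rw [star_propagator_eq hH, propagator_mul hH, neg_add_cancel, propagator_zero]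

theorem propagator_pow (hH : IsSelfAdjoint H) (t : ℝ) (j : ℕ) :
    propagator H t ^ j = propagator H (j * t) := by
  induction j with
  | zero => simp [propagator_zero]
  | succ j ih =>
    rw [pow_succ, ih, propagator_mul hH]
    push_cast
    congr 1
    ring

theorem propagator_sub_smul_eq_cfc (hH : IsSelfAdjoint H) (t : ℝ) (c : ℂ) :
    propagator H t - c • 1 =
      cfc (fun z : ℂ => Complex.exp (-(Complex.I * (t : ℂ)) * z) - c) H := by
  have hn : IsStarNormal H := hH.isStarNormal
  rw [propagator_eq_cfc hH, cfc_sub _ _ H, cfc_const c H, Algebra.algebraMap_eq_smul_one]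

/-- The basic time step `2π(N-1)/(NΛ)`. -/
def timeStep (N : ℕ) (Λ : ℝ) : ℝ := 2 * Real.pi * ((N : ℝ) - 1) / ((N : ℝ) * Λ)

/-- The energy levels `Λk/(N-1)`. -/
def energyLevel (N : ℕ) (Λ : ℝ) (k : ℕ) : ℝ := Λ / ((N : ℝ) - 1) * k

variable {N : ℕ} {Λ : ℝ}

theorem timeStep_pos (hN : 2 ≤ N) (hΛ : 0 < Λ) : 0 < timeStep N Λ := by
  have h2 : (2 : ℝ) ≤ N := by exact_mod_cast hN
  have : (0 : ℝ) < (N : ℝ) - 1 := by linarith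
  unfold timeStep
  positivity

/-- The phases of the spectrum after one step leave a gap of length `2π / N` on the circle; both the
kernel inequality and the recovery of energies from phases rest on it. -/
theorem timeStep_mul (hN : 2 ≤ N) (hΛ : 0 < Λ) :
    timeStep N Λ * Λ = 2 * Real.pi - 2 * (Real.pi / N) := by
  have h2 : (2 : ℝ) ≤ N := by exact_mod_cast hN
  unfold timeStep
  field_simp

theorem timeStep_mul_energyLevel (hN : 2 ≤ N) (hΛ : 0 < Λ) (k : ℕ) :
    timeStep N Λ * energyLevel N Λ k = 2 * Real.pi * k / N := by
  have h2 : (2 : ℝ) ≤ N := by exact_mod_cast hN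
  have : (N : ℝ) - 1 ≠ 0 := by linarith
  unfold timeStep energyLevel
  field_simp

theorem energyLevel_mem_Icc (hN : 2 ≤ N) (hΛ : 0 < Λ) (k : Fin N) :
    energyLevel N Λ k ∈ Set.Icc 0 Λ := by
  have h2 : (2 : ℝ) ≤ N := by exact_mod_cast hN
  have h3 : (0 : ℝ) < (N : ℝ) - 1 := by linarith
  have h4 : ((k : ℕ) : ℝ) ≤ (N : ℝ) - 1 := by
    have : (k : ℕ) + 1 ≤ N := k.2
    have : (((k : ℕ) + 1 : ℕ) : ℝ) ≤ N := by exact_mod_cast this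
    push_cast at this
    linarith
  refine ⟨by unfold energyLevel; positivity, ?_⟩
  rw [energyLevel, div_mul_eq_mul_div, div_le_iff₀ h3]
  gcongr

theorem exp_timeStep_energyLevel (hN : 2 ≤ N) (hΛ : 0 < Λ) (k : Fin N) :
    Complex.exp (-(Complex.I * ((timeStep N Λ * energyLevel N Λ k : ℝ) : ℂ))) =
      (unityRoot N ^ (k : ℕ))⁻¹ := by
  rw [timeStep_mul_energyLevel hN hΛ, unityRoot, ← Complex.exp_nat_mul, ← Complex.exp_neg]
  congr 1
  push_cast
  ring

/-- The constant that compares energy differences with phase differences after one time step. -/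
def phaseConst (N : ℕ) (Λ : ℝ) : ℝ := Real.pi / Real.sin (Real.pi / N) / timeStep N Λ

theorem phaseConst_nonneg (hN : 2 ≤ N) (hΛ : 0 < Λ) : 0 ≤ phaseConst N Λ := by
  have := sin_pi_div_pos hN
  have := timeStep_pos hN hΛ
  unfold phaseConst
  positivity

/-- At time `t` the chord is at most the arc `|t| |x - y|`. After one step the arc is at most `2π -
2π/N`, so it is in turn bounded by a multiple of its chord. -/
theorem norm_exp_sub_exp_le_phaseConst (hN : 2 ≤ N) (hΛ : 0 < Λ) {x y : ℝ}
    (hx : x ∈ Set.Icc 0 Λ) (hy : y ∈ Set.Icc 0 Λ) (t : ℝ) :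
    ‖Complex.exp (-(Complex.I * ((t * x : ℝ) : ℂ))) -
        Complex.exp (-(Complex.I * ((t * y : ℝ) : ℂ)))‖ ≤
      |t| * phaseConst N Λ * ‖Complex.exp (-(Complex.I * ((timeStep N Λ * x : ℝ) : ℂ))) -
        Complex.exp (-(Complex.I * ((timeStep N Λ * y : ℝ) : ℂ)))‖ := by
  have ht := timeStep_pos hN hΛ
  refine (norm_exp_sub_exp_le _ _).trans ?_
  have h1 : |timeStep N Λ * x - timeStep N Λ * y| = timeStep N Λ * |x - y| := by
    rw [← mul_sub, abs_mul, abs_of_pos ht]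
  have h2 : |x - y| ≤ Λ := by
    rw [abs_le]
    exact ⟨by linarith [hx.1, hy.2], by linarith [hx.2, hy.1]⟩
  have h3 := abs_sub_le_norm_exp_sub_exp hN (a := timeStep N Λ * x) (b := timeStep N Λ * y) (by
    rw [h1, ← timeStep_mul hN hΛ]
    gcongr)
  rw [← mul_sub, abs_mul, mul_assoc]
  gcongr
  rw [h1, ← le_div_iff₀' ht] at h3
  refine h3.trans (le_of_eq ?_)
  unfold phaseConst
  ring

/-- Lifts the scalar comparison of phases to operators, so that the error of `U` on a level controls
that of `e^{-iHt}` for every `t`. -/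
theorem norm_propagator_sub_apply_le (hH : IsSelfAdjoint H) (hs : spectrum ℝ H ⊆ Set.Icc 0 Λ)
    (hN : 2 ≤ N) (hΛ : 0 < Λ) (k : Fin N) (t : ℝ) (y : E) :
    ‖(propagator H t - Complex.exp (-(Complex.I * ((t * energyLevel N Λ k : ℝ) : ℂ))) • 1) y‖ ≤
      ‖((|t| * phaseConst N Λ : ℝ) : ℂ) •
        (unityRoot N ^ (k : ℕ) • propagator H (timeStep N Λ) - 1) y‖ := by
  have hn : IsStarNormal H := hH.isStarNormal
  have hN0 : N ≠ 0 := by omega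
  have hω : unityRoot N ^ (k : ℕ) ≠ 0 := pow_ne_zero _ (unityRoot_ne_zero hN0)
  have h1 : ((|t| * phaseConst N Λ : ℝ) : ℂ) •
        (unityRoot N ^ (k : ℕ) • propagator H (timeStep N Λ) - 1) =
      cfc (fun z : ℂ => (((|t| * phaseConst N Λ : ℝ) : ℂ) * unityRoot N ^ (k : ℕ)) *
        (Complex.exp (-(Complex.I * (timeStep N Λ : ℂ)) * z)
          - (unityRoot N ^ (k : ℕ))⁻¹)) H := by
    rw [cfc_const_mul _ _ H, ← propagator_sub_smul_eq_cfc hH, mul_smul, smul_sub (unityRoot N ^ _),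
      smul_smul (unityRoot N ^ _), mul_inv_cancel₀ hω, one_smul]
  rw [← smul_apply, h1, propagator_sub_smul_eq_cfc hH]
  refine norm_cfc_apply_le hH hs (by fun_prop) (by fun_prop) (fun x hx => ?_) y
  have h2 := norm_exp_sub_exp_le_phaseConst hN hΛ hx (energyLevel_mem_Icc hN hΛ k) t
  rw [exp_timeStep_energyLevel hN hΛ] at h2
  rw [norm_mul, norm_mul, norm_pow, norm_unityRoot hN0, one_pow, mul_one, Complex.norm_real,
    Real.norm_of_nonneg (mul_nonneg (abs_nonneg _) (phaseConst_nonneg hN hΛ))]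
  push_cast at h2 ⊢
  convert h2 using 4 <;> ring_nf

theorem NearlyCyclic.norm_amp_propagator_sub {w : lp (fun _ : ι => E) 2} {M₀ : E →L[ℂ] E}
    {η ζ : ℝ} (h : NearlyCyclic N w (propagator H (timeStep N Λ)) M₀ η ζ)
    (hH : IsSelfAdjoint H) (hs : spectrum ℝ H ⊆ Set.Icc 0 Λ) (hΛ : 0 < Λ) (k : Fin N) (t : ℝ) :
    ‖amp w (propagator H t * levelOp (propagator H (timeStep N Λ)) k
      - Complex.exp (-(Complex.I * ((t * energyLevel N Λ k : ℝ) : ℂ))) •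
        levelOp (propagator H (timeStep N Λ)) k)‖ ≤ |t| * phaseConst N Λ * ζ := by
  set U := propagator H (timeStep N Λ) with hU
  set c := Complex.exp (-(Complex.I * ((t * energyLevel N Λ k : ℝ) : ℂ))) with hc
  have hκ := phaseConst_nonneg h.two_le hΛ
  have h1 : propagator H t * levelOp U k - c • levelOp U k =
      (propagator H t - c • 1) * levelOp U k := by
    rw [sub_mul, smul_mul_assoc, one_mul]
  have h2 : ‖amp w ((propagator H t - c • 1) * levelOp U k)‖ ≤
      ‖amp w (((|t| * phaseConst N Λ : ℝ) : ℂ) •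
        ((unityRoot N ^ (k : ℕ) • U - 1) * levelOp U k))‖ :=
    norm_amp_mono w fun x => norm_propagator_sub_apply_le hH hs h.two_le hΛ k t (levelOp U k x)
  rw [h1]
  refine h2.trans ?_
  rw [map_smul, norm_smul, Complex.norm_real,
    Real.norm_of_nonneg (mul_nonneg (abs_nonneg _) hκ)]
  gcongr
  exact (h.norm_amp_phase_sub_one k).trans (div_le_self h.zeta_nonneg h.one_le_cast)

theorem inner_amp_star (w : lp (fun _ : ι => E) 2) (X : E →L[ℂ] E) :
    ⟪w, amp w (star X)⟫_ℂ = starRingEnd ℂ ⟪w, amp w X⟫_ℂ := by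
  have h1 := inner_amp_eq w X 1
  have h2 : adjoint X ∘L (1 : E →L[ℂ] E) = star X := by
    ext x
    rfl
  rw [h2, amp_one] at h1
  rw [← h1, inner_conj_symm]

/-- The kernel inequality, read through the functional calculus, bounds the left side by a
combination of the moments `⟨w, U^k w⟩` with `k < N`. The moment `k = 0`, which is not small, has
coefficient `sin 0 = 0`. -/
theorem norm_amp_propagator_sub_one_sq_le (hH : IsSelfAdjoint H)
    (hs : spectrum ℝ H ⊆ Set.Icc 0 Λ) (hN : 2 ≤ N) (hΛ : 0 < Λ) (w : lp (fun _ : ι => E) 2)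
    {η : ℝ} (hη : 0 ≤ η) (hw : ∀ j, 0 < j → j < N →
      ‖⟪w, amp w (propagator H (j * timeStep N Λ))⟫_ℂ‖ ≤ 2 * η) :
    ‖amp w (propagator H (N * timeStep N Λ) - 1)‖ ^ 2 ≤
      16 * N / Real.sin (Real.pi / N) * η := by
  have hn : IsStarNormal H := hH.isStarNormal
  have h2 : (2 : ℝ) ≤ N := by exact_mod_cast hN
  set b := Real.pi / N with hb
  set τ := timeStep N Λ with hτ
  have hτ0 : 0 < τ := timeStep_pos hN hΛ
  have hsb : 0 < Real.sin b := sin_pi_div_pos hN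
  have hNb : N * b = Real.pi := by rw [hb]; field_simp
  -- The phase `e^{-ikb}` shifts the variable by `b`: twice the real part of `g` is the kernel at `τ
  -- x + b`, which runs over `[b, 2π - b]`.
  set c : ℕ → ℂ := fun k => (Real.sin (k * b) : ℂ) * Complex.exp (-(Complex.I * (k * b : ℝ)))
    with hc
  set g : ℂ → ℂ := fun z => ∑ k ∈ Finset.range N,
    c k * Complex.exp (-(Complex.I * ((k * τ : ℝ) : ℂ)) * z) with hg
  set f : ℂ → ℂ := fun z => Complex.exp (-(Complex.I * ((N * τ : ℝ) : ℂ)) * z) - 1 with hf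
  have hgc : Continuous g := by
    rw [hg]
    fun_prop
  have hfc : Continuous f := by
    rw [hf]
    fun_prop
  set X := cfc g H with hX
  set Y := cfc f H with hY
  have hYe : Y = propagator H (N * τ) - 1 := by
    have := propagator_sub_smul_eq_cfc hH (N * τ) 1
    rw [one_smul] at this
    exact this.symm
  have hXe : X = ∑ k ∈ Finset.range N, c k • propagator H (k * τ) := by
    have h1 : g = ∑ k ∈ Finset.range N,
        fun z : ℂ => c k * Complex.exp (-(Complex.I * ((k * τ : ℝ) : ℂ)) * z) := by
      funext z
      rw [hg, Finset.sum_apply]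
    rw [hX, h1, cfc_sum _ H _ fun k _ => (by fun_prop : Continuous _).continuousOn]
    refine Finset.sum_congr rfl fun k _ => ?_
    rw [cfc_const_mul _ _ H, propagator_eq_cfc hH]
  have hpos : (cfc (fun z => ((-(4 / Real.sin b) : ℝ) : ℂ) * (g z + star (g z))
      - star (f z) * f z) H).IsPositive := by
    refine isPositive_cfc hH hs fun x hx =>
      ⟨4 / Real.sin b * -sineKernel N b (τ * x + b) - ‖f x‖ ^ 2, ?_, ?_⟩
    · have hx1 : b ≤ τ * x + b := by
        have := mul_nonneg hτ0.le hx.1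
        linarith
      have hx2 : τ * x + b ≤ 2 * Real.pi - b := by
        have h3 : τ * x ≤ τ * Λ := mul_le_mul_of_nonneg_left hx.2 hτ0.le
        rw [hτ, timeStep_mul hN hΛ, ← hτ, ← hb] at h3
        linarith
      have h3 := one_add_cos_le_neg_sineKernel hN hx1 hx2
      rw [← hb] at h3
      have h4 : ‖f x‖ ^ 2 = 2 * (1 + Real.cos (N * (τ * x + b))) := by
        -- The shift by `b` adds `N b = π` to the angle and so turns `1 - cos` into `1 + cos`.
        have h5 := norm_exp_sub_one_sq (N * τ * x)
        have h6 : N * (τ * x + b) = N * τ * x + Real.pi := by rw [mul_add, hNb]; ring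
        rw [h6, Real.cos_add_pi]
        have h7 : f x = Complex.exp (-(Complex.I * ((N * τ * x : ℝ) : ℂ))) - 1 := by
          rw [hf]
          push_cast
          ring_nf
        rw [h7, h5]
        ring
      rw [h4, div_mul_eq_mul_div, sub_nonneg, le_div_iff₀ hsb]
      linarith
    · have h3 : g x + star (g x) = (sineKernel N b (τ * x + b) : ℝ) := by
        rw [Complex.star_def, Complex.add_conj, sineKernel]
        congr 1
        rw [hg, Complex.re_sum, Finset.mul_sum]
        refine Finset.sum_congr rfl fun k _ => ?_
        have h4 : c k * Complex.exp (-(Complex.I * ((k * τ : ℝ) : ℂ)) * x) =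
            (Real.sin (k * b) : ℂ) *
              Complex.exp (((-(k * (τ * x + b)) : ℝ) : ℂ) * Complex.I) := by
          rw [hc, mul_assoc, ← Complex.exp_add]
          congr 2
          push_cast
          ring
        rw [h4, Complex.re_ofReal_mul, Complex.exp_ofReal_mul_I_re, Real.cos_neg, mul_assoc]
      rw [h3, Complex.star_def, Complex.conj_mul']
      push_cast
      ring
  rw [cfc_sub _ _ H, cfc_const_mul _ _ H, cfc_add H g _, cfc_mul _ _ H, cfc_star, cfc_star,
    ← hX, ← hY] at hpos
  have h3 := re_inner_amp_nonneg w hpos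
  have h4 : ⟪w, amp w (star Y * Y)⟫_ℂ = ((‖amp w Y‖ ^ 2 : ℝ) : ℂ) := by
    have := inner_amp_eq w Y Y
    rw [inner_self_eq_norm_sq_to_K] at this
    push_cast
    exact this.symm
  have h5 : ‖⟪w, amp w X⟫_ℂ‖ ≤ N * (2 * η) := by
    rw [hXe, map_sum, inner_sum]
    refine (norm_sum_le _ _).trans
      ((Finset.sum_le_card_nsmul _ _ (2 * η) fun k hk => ?_).trans (by simp))
    have h6 : ‖c k‖ = |Real.sin (k * b)| := by
      have h7 : -(Complex.I * ((k * b : ℝ) : ℂ)) = ((-(k * b) : ℝ) : ℂ) * Complex.I := by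
        push_cast
        ring
      rw [hc, norm_mul, h7, Complex.norm_exp_ofReal_mul_I, mul_one, Complex.norm_real,
        Real.norm_eq_abs]
    rw [map_smul, inner_smul_right, norm_mul, h6]
    rcases Nat.eq_zero_or_pos k with rfl | hk0
    · simpa using hη
    · exact (mul_le_of_le_one_left (norm_nonneg _) (Real.abs_sin_le_one _)).trans
        (hw k hk0 (Finset.mem_range.1 hk))
  rw [map_sub, map_smul, map_add, inner_sub_right, inner_smul_right, inner_add_right,
    inner_amp_star, Complex.add_conj, h4, ← Complex.ofReal_mul, ← Complex.ofReal_sub,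
    Complex.ofReal_re] at h3
  have h6 : -(⟪w, amp w X⟫_ℂ).re ≤ N * (2 * η) :=
    (neg_le_abs _).trans ((Complex.abs_re_le_norm _).trans h5)
  rw [← hYe]
  have h7 : 4 / Real.sin b * (2 * -(⟪w, amp w X⟫_ℂ).re) ≤ 4 / Real.sin b * (2 * (N * (2 * η))) := by
    gcongr
  calc ‖amp w Y‖ ^ 2 ≤ 4 / Real.sin b * (2 * (N * (2 * η))) := by linarith
    _ = _ := by ring

end Evolution

/-! ### The reference realization -/

section Reference

theorem exp_apply_of_eigenvector {E : Type*} [NormedAddCommGroup E] [NormedSpace ℂ E]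
    [CompleteSpace E] {A : E →L[ℂ] E} {v : E} {μ : ℂ} (h : A v = μ • v) :
    NormedSpace.exp A v = Complex.exp μ • v := by
  have hpow : ∀ n : ℕ, (A ^ n) v = μ ^ n • v := by
    intro n
    induction n with
    | zero => simp
    | succ n ih => rw [pow_succ, mul_apply_eq_comp, h, map_smul, ih, smul_smul, pow_succ, mul_comm]
  have h1 := (NormedSpace.exp_series_hasSum_exp' (𝕂 := ℂ) A).mapL
    (ContinuousLinearMap.apply ℂ E v)
  have h2 := (NormedSpace.exp_series_hasSum_exp' (𝕂 := ℂ) μ).smul_const v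
  rw [← Complex.exp_eq_exp_ℂ] at h2
  refine HasSum.unique h1 ?_
  convert h2 using 1
  funext n
  change ((n.factorial : ℂ)⁻¹ • A ^ n) v = _
  rw [smul_apply, hpow, smul_eq_mul, mul_smul]

variable (N : ℕ) (Λ : ℝ)

theorem proj_isSelfAdjoint {E : Type*} [NormedAddCommGroup E] [InnerProductSpace ℂ E]
    [CompleteSpace E] (ψ : E) : IsSelfAdjoint (proj ψ) :=
  InnerProductSpace.adjoint_rankOne ψ ψ

theorem refHamiltonian_isSelfAdjoint : IsSelfAdjoint (refHamiltonian N Λ) := by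
  unfold refHamiltonian
  refine IsSelfAdjoint.smul (Complex.conj_ofReal _) ?_
  rw [IsSelfAdjoint, star_eq_adjoint, map_sum]
  exact Finset.sum_congr rfl fun k _ =>
    IsSelfAdjoint.smul (Complex.conj_natCast _) (proj_isSelfAdjoint _)

theorem inner_single_single (l k : Fin N) :
    ⟪EuclideanSpace.single l (1 : ℂ), EuclideanSpace.single k (1 : ℂ)⟫_ℂ =
      if l = k then 1 else 0 := by
  rw [EuclideanSpace.inner_single_left]
  simp

theorem refHamiltonian_single (k : Fin N) :
    refHamiltonian N Λ (EuclideanSpace.single k 1) =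
      (energyLevel N Λ k : ℂ) • EuclideanSpace.single k 1 := by
  unfold refHamiltonian energyLevel
  rw [smul_apply, sum_apply, Finset.sum_eq_single k]
  · rw [smul_apply, proj, InnerProductSpace.rankOne_apply, inner_single_single, if_pos rfl,
      one_smul, smul_smul]
    push_cast
    rfl
  · intro l _ hl
    rw [smul_apply, proj, InnerProductSpace.rankOne_apply, inner_single_single, if_neg hl,
      zero_smul, smul_zero]
  · simp

theorem propagator_refHamiltonian_refVector (t : ℝ) :
    propagator (refHamiltonian N Λ) t (refVector N) =
      ∑ k : Fin N, (Complex.exp (-(Complex.I * ((t * energyLevel N Λ k : ℝ) : ℂ))) *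
        (((√N)⁻¹ : ℝ) : ℂ)) • EuclideanSpace.single k 1 := by
  unfold refVector
  rw [map_smul, map_sum, Finset.smul_sum]
  refine Finset.sum_congr rfl fun k _ => ?_
  have h : ((-(Complex.I * (t : ℂ))) • refHamiltonian N Λ) (EuclideanSpace.single k 1) =
      (-(Complex.I * ((t * energyLevel N Λ k : ℝ) : ℂ))) • EuclideanSpace.single k (1 : ℂ) := by
    rw [smul_apply, refHamiltonian_single, smul_smul]
    congr 1
    push_cast
    ring
  rw [propagator, exp_apply_of_eigenvector h, smul_smul, mul_comm]

theorem norm_refVector (hN : N ≠ 0) : ‖refVector N‖ = 1 := by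
  have h : refVector N = WithLp.toLp 2 fun _ : Fin N => (((√N)⁻¹ : ℝ) : ℂ) := by
    ext k
    simp [refVector, Pi.single_apply]
  have hN' : (0 : ℝ) < N := by positivity
  rw [h, EuclideanSpace.norm_eq]
  simp [hN]

theorem refVector_eq_sum :
    refVector N = ∑ k : Fin N, (((√N)⁻¹ : ℝ) : ℂ) • EuclideanSpace.single k 1 := by
  rw [refVector, Finset.smul_sum]

theorem norm_propagator_apply {E : Type*} [NormedAddCommGroup E] [InnerProductSpace ℂ E]
    [CompleteSpace E] {H : E →L[ℂ] E} (hH : IsSelfAdjoint H) (t : ℝ) (x : E) :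
    ‖propagator H t x‖ = ‖x‖ := by
  refine (sq_eq_sq₀ (norm_nonneg _) (norm_nonneg _)).1 ?_
  rw [norm_apply_sq_eq_re_inner]
  have h : adjoint (propagator H t) ∘L propagator H t = 1 := star_propagator_mul_self hH t
  rw [h]
  exact inner_self_eq_norm_sq (𝕜 := ℂ) x

/-- Puts the reference side into the form of the target in `norm_amp_dilation_meas_comp_sub`. -/
theorem refMeas_zero_propagator (t : ℝ) :
    refMeas N 0 (propagator (refHamiltonian N Λ) t (refVector N)) =
      ((N : ℂ)⁻¹ * ∑ k : Fin N,
        Complex.exp (-(Complex.I * ((t * energyLevel N Λ k : ℝ) : ℂ)))) •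
      ∑ k : Fin N, (((√N)⁻¹ : ℝ) : ℂ) • EuclideanSpace.single k 1 := by
  have hi : ⟪refVector N, propagator (refHamiltonian N Λ) t (refVector N)⟫_ℂ =
      (N : ℂ)⁻¹ * ∑ k : Fin N,
        Complex.exp (-(Complex.I * ((t * energyLevel N Λ k : ℝ) : ℂ))) := by
    rw [propagator_refHamiltonian_refVector, inner_sum, Finset.mul_sum]
    refine Finset.sum_congr rfl fun k _ => ?_
    have h1 : ⟪refVector N, EuclideanSpace.single k (1 : ℂ)⟫_ℂ = (((√N)⁻¹ : ℝ) : ℂ) := by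
      rw [refVector, inner_smul_left, sum_inner]
      simp_rw [inner_single_single]
      simp
    have h2 : (((√N)⁻¹ : ℝ) : ℂ) * (((√N)⁻¹ : ℝ) : ℂ) = (N : ℂ)⁻¹ := by
      rw [← Complex.ofReal_mul, ← mul_inv, Real.mul_self_sqrt (by positivity)]
      simp
    rw [inner_smul_right, h1, mul_assoc, h2, mul_comm]
  rw [← hi, ← refVector_eq_sum]
  rfl

theorem refMeas_one_apply (x : EuclideanSpace ℂ (Fin N)) :
    refMeas N 1 x = x - refMeas N 0 x := rfl

theorem norm_refMeas_apply_le (hN : N ≠ 0) (a : Fin 2) (x : EuclideanSpace ℂ (Fin N)) :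
    ‖refMeas N a x‖ ≤ 2 * ‖x‖ := by
  have h0 : ‖refMeas N 0 x‖ ≤ ‖x‖ := by
    have h1 : refMeas N 0 x = ⟪refVector N, x⟫_ℂ • refVector N := rfl
    rw [h1, norm_smul, norm_refVector N hN, mul_one]
    refine (norm_inner_le_norm _ _).trans ?_
    rw [norm_refVector N hN, one_mul]
  have hx := norm_nonneg x
  fin_cases a
  · exact h0.trans (by linarith)
  · change ‖refMeas N 1 x‖ ≤ _
    rw [refMeas_one_apply]
    exact (norm_sub_le _ _).trans (by linarith)

end Reference

/-! ### Purification of a density operator -/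

section Purification

variable {E F : Type*} [NormedAddCommGroup E] [InnerProductSpace ℂ E] [CompleteSpace E]
  [NormedAddCommGroup F] [InnerProductSpace ℂ F] [CompleteSpace F]

/-- A self-adjoint square root `Ψ` of `ρ` together with the unit vector `(Ψ eᵢ)ᵢ`. -/
structure IsPurification (ρ Ψ : E →L[ℂ] E) (w : lp (fun _ : basisIndex E => E) 2) : Prop where
  isSelfAdjoint : IsSelfAdjoint Ψ
  mul_self : Ψ * Ψ = ρ
  apply_eq : ∀ i, w i = Ψ (onb E i)
  norm_eq_one : ‖w‖ = 1

theorem IsDensityOperator.exists_isPurification {ρ : E →L[ℂ] E} (h : IsDensityOperator ρ) :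
    ∃ Ψ w, IsPurification ρ Ψ w := by
  have hρ : 0 ≤ ρ := (nonneg_iff_isPositive ρ).2 h.1
  set Ψ := CFC.sqrt ρ
  have hsa : IsSelfAdjoint Ψ := (CFC.sqrt_nonneg ρ).isSelfAdjoint
  have hmul : Ψ * Ψ = ρ := CFC.sqrt_mul_sqrt_self ρ
  have hi : ∀ i, ⟪onb E i, ρ (onb E i)⟫_ℂ = ((‖Ψ (onb E i)‖ ^ 2 : ℝ) : ℂ) := by
    intro i
    have h1 : adjoint Ψ = Ψ := hsa
    rw [← hmul, mul_apply_eq_comp, ← adjoint_inner_left, h1, inner_self_eq_norm_sq_to_K]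
    norm_cast
  have htr := h.2
  unfold trace at htr
  simp_rw [hi] at htr
  rw [← Complex.ofReal_tsum] at htr
  have htr' : ∑' i, ‖Ψ (onb E i)‖ ^ 2 = 1 := by exact_mod_cast htr
  have hsum : Summable fun i => ‖Ψ (onb E i)‖ ^ 2 := by
    -- A divergent series would have the default sum `0`, contradicting trace one.
    by_contra hns
    rw [tsum_eq_zero_of_not_summable hns] at htr'
    exact zero_ne_one htr'
  refine ⟨Ψ, ⟨fun i => Ψ (onb E i), memlp_two_iff.2 hsum⟩, hsa, hmul, fun i => rfl, ?_⟩
  have h2 := lp_norm_sq_eq_tsum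
    (⟨fun i => Ψ (onb E i), memlp_two_iff.2 hsum⟩ : lp (fun _ : basisIndex E => E) 2)
  rw [htr'] at h2
  exact (pow_eq_one_iff_of_nonneg (norm_nonneg _) two_ne_zero).1 h2

namespace IsPurification

variable {ρ Ψ : E →L[ℂ] E} {w : lp (fun _ : basisIndex E => E) 2}

theorem hsSq_comp (h : IsPurification ρ Ψ w) (X : E →L[ℂ] F) :
    hsSq (onb E) (X ∘L Ψ) = ENNReal.ofReal (‖amp w X‖ ^ 2) := by
  rw [lp_norm_sq_eq_tsum, ENNReal.ofReal_tsum_of_nonneg (fun _ => by positivity)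
    (memlp_two_iff.1 (amp w X).2)]
  unfold hsSq
  refine tsum_congr fun i => ?_
  rw [amp_apply, h.apply_eq, comp_apply]

theorem trace_comp (h : IsPurification ρ Ψ w) (X Y : E →L[ℂ] F) :
    trace ((X ∘L Ψ) ∘L adjoint (Y ∘L Ψ)) = ⟪amp w Y, amp w X⟫_ℂ := by
  rw [trace_comp_adjoint (onb E) (by rw [h.hsSq_comp]; exact ENNReal.ofReal_ne_top)
    (by rw [h.hsSq_comp]; exact ENNReal.ofReal_ne_top), inner_amp]
  refine tsum_congr fun i => ?_
  rw [comp_apply, comp_apply, h.apply_eq]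

theorem norm_amp_le (h : IsPurification ρ Ψ w) (X : E →L[ℂ] F) : ‖amp w X‖ ≤ ‖X‖ := by
  have h1 := norm_amp_comp_le w X (1 : E →L[ℂ] E)
  rw [amp_one, h.norm_eq_one, mul_one] at h1
  exact h1

theorem mul_evolve (h : IsPurification ρ Ψ w) {H : E →L[ℂ] E} (hH : IsSelfAdjoint H)
    (M : E →L[ℂ] E) (t : ℝ) : M * evolve H ρ t =
      ((M * propagator H t) ∘L Ψ) ∘L adjoint (propagator H t ∘L Ψ) := by
  have h1 : adjoint Ψ = Ψ := h.isSelfAdjoint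
  have h2 : adjoint (propagator H t) = NormedSpace.exp ((Complex.I * (t : ℂ)) • H) :=
    star_propagator hH t
  rw [adjoint_comp, h1, h2, evolve, ← h.mul_self]
  rfl

theorem evolve_mul (h : IsPurification ρ Ψ w) {H M : E →L[ℂ] E} (hH : IsSelfAdjoint H)
    (hM : IsSelfAdjoint M) (t : ℝ) : evolve H ρ t * M =
      (propagator H t ∘L Ψ) ∘L adjoint ((M * propagator H t) ∘L Ψ) := by
  have h1 : adjoint Ψ = Ψ := h.isSelfAdjoint
  have h2 : adjoint (M * propagator H t) =
      NormedSpace.exp ((Complex.I * (t : ℂ)) • H) * M := by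
    rw [← star_propagator hH t, ← star_eq_adjoint, star_mul, hM.star_eq]
  rw [adjoint_comp, h1, h2, evolve, ← h.mul_self]
  rfl

end IsPurification

end Purification

/-! ### Measurement operators -/

section Measurement

variable {ι E : Type*} [NormedAddCommGroup E] [InnerProductSpace ℂ E] [CompleteSpace E]

/-- This is `M² ≤ M`, from `M(1-M) = (1-M)M(1-M) + M(1-M)M`. It bounds squared norms by outcome
probabilities although `M` need not be a projection. -/
theorem re_inner_one_sub_nonneg {M : E →L[ℂ] E} (h0 : M.IsPositive) (h1 : (1 - M).IsPositive)
    (x : E) : 0 ≤ (⟪M x, (1 - M) x⟫_ℂ).re := by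
  have hid : ⟪M x, (1 - M) x⟫_ℂ =
      ⟪(1 - M) x, M ((1 - M) x)⟫_ℂ + ⟪M x, (1 - M) (M x)⟫_ℂ := by
    rw [← h0.inner_left_eq_inner_right ((1 - M) x)]
    have h2 : M ((1 - M) x) = (1 - M) (M x) := by simp
    rw [h2, ← h1.inner_left_eq_inner_right (M x), h1.inner_left_eq_inner_right (M x),
      h1.inner_left_eq_inner_right (M x), ← inner_add_right]
    simp
  rw [hid, Complex.add_re]
  exact add_nonneg (h0.re_inner_nonneg_right _) (h1.re_inner_nonneg_right _)

theorem norm_amp_sq_le_re_inner {M : E →L[ℂ] E} (h0 : M.IsPositive) (h1 : (1 - M).IsPositive)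
    (w : lp (fun _ : ι => E) 2) (X : E →L[ℂ] E) :
    ‖amp w (M * X)‖ ^ 2 ≤ (⟪amp w (M * X), amp w X⟫_ℂ).re := by
  have h2 : 0 ≤ (⟪amp w (M * X), amp w ((1 - M) * X)⟫_ℂ).re := by
    rw [lp.inner_eq_tsum, Complex.re_tsum (lp.summable_inner (𝕜 := ℂ) _ _)]
    exact tsum_nonneg fun i => re_inner_one_sub_nonneg h0 h1 (X (w i))
  rw [sub_mul, one_mul, map_sub, inner_sub_right, Complex.sub_re] at h2
  have h3 : (⟪amp w (M * X), amp w (M * X)⟫_ℂ).re = ‖amp w (M * X)‖ ^ 2 :=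
    inner_self_eq_norm_sq (𝕜 := ℂ) _
  linarith

theorem norm_le_one_of_isPositive {M : E →L[ℂ] E} (h0 : M.IsPositive) (h1 : (1 - M).IsPositive) :
    ‖M‖ ≤ 1 := by
  refine opNorm_le_bound _ zero_le_one fun x => ?_
  have h2 := re_inner_one_sub_nonneg h0 h1 x
  rw [sub_apply, inner_sub_right, Complex.sub_re, one_apply_eq_self] at h2
  have h3 : (⟪M x, M x⟫_ℂ).re = ‖M x‖ ^ 2 := inner_self_eq_norm_sq (𝕜 := ℂ) _
  have h4 : (⟪M x, x⟫_ℂ).re ≤ ‖M x‖ * ‖x‖ :=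
    (Complex.re_le_norm _).trans (norm_inner_le_norm _ _)
  rw [one_mul]
  by_contra hlt
  push Not at hlt
  nlinarith [norm_nonneg x, norm_nonneg (M x)]

end Measurement

/-! ### The self-testing estimate -/

section Estimate

variable {E : Type*} [NormedAddCommGroup E] [InnerProductSpace ℂ E] [CompleteSpace E] {N : ℕ}

theorem adjoint_embL_tmul (v x : EuclideanSpace ℂ (Fin N)) (y : WithLp 2 (E × E)) :
    adjoint (embL v : E →L[ℂ] _) (x ⊗ₜ[ℂ] y) = ⟪v, x⟫_ℂ • adjoint inlL y := by
  refine ext_inner_left ℂ fun z => ?_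
  rw [adjoint_inner_right, inner_smul_right, adjoint_inner_right, embL, comp_apply, tmulL_apply,
    TensorProduct.inner_tmul]

/-- Factors the target operator through `Ψ` just as the physical one is factored, so that the two
can be compared on `w`. -/
theorem mapL_rankOne_eq {Ψ : E →L[ℂ] E} (hΨ : IsSelfAdjoint Ψ)
    (v v' : EuclideanSpace ℂ (Fin N)) :
    TensorProduct.mapL (InnerProductSpace.rankOne ℂ v v')
        (inlL ∘L (Ψ * Ψ) ∘L adjoint inlL) =
      (embL v ∘L Ψ) ∘L adjoint (embL v' ∘L Ψ) := by
  have h1 : adjoint Ψ = Ψ := hΨ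
  refine ContinuousLinearMap.ext fun z => ?_
  induction z using TensorProduct.induction_on with
  | zero => simp
  | add a b ha hb => rw [map_add, map_add, ha, hb]
  | tmul x y =>
    rw [TensorProduct.mapL_tmul, InnerProductSpace.rankOne_apply, adjoint_comp, h1,
      comp_apply _ (Ψ ∘L _), comp_apply Ψ, adjoint_embL_tmul, map_smul, map_smul,
      ← TensorProduct.smul_tmul']
    rfl

theorem mul_evolve_proj {F : Type*} [NormedAddCommGroup F] [InnerProductSpace ℂ F]
    [CompleteSpace F] {H : F →L[ℂ] F} (hH : IsSelfAdjoint H) (M : F →L[ℂ] F) (ψ : F) (t : ℝ) :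
    M * evolve H (proj ψ) t =
      InnerProductSpace.rankOne ℂ (M (propagator H t ψ)) (propagator H t ψ) := by
  refine ContinuousLinearMap.ext fun x => ?_
  rw [InnerProductSpace.rankOne_apply, ← adjoint_inner_right]
  have h2 : adjoint (propagator H t) = NormedSpace.exp ((Complex.I * (t : ℂ)) • H) :=
    star_propagator hH t
  rw [h2, ← map_smul, ← map_smul]
  rfl

theorem isDensityOperator_inlL {ρ Ψ : E →L[ℂ] E} {w : lp (fun _ : basisIndex E => E) 2}
    (h : IsPurification ρ Ψ w) (hρ : ρ.IsPositive) :
    IsDensityOperator ((inlL : E →L[ℂ] _) ∘L ρ ∘L adjoint inlL) := by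
  refine ⟨hρ.conj_adjoint inlL, ?_⟩
  have h1 : adjoint Ψ = Ψ := h.isSelfAdjoint
  have h2 : (inlL : E →L[ℂ] _) ∘L ρ ∘L adjoint inlL =
      (inlL ∘L Ψ) ∘L adjoint (inlL ∘L Ψ) := by
    rw [adjoint_comp, h1, ← h.mul_self]
    rfl
  rw [h2, h.trace_comp, inner_self_eq_norm_sq_to_K]
  have h3 : ‖amp w (inlL : E →L[ℂ] _)‖ = ‖amp w (1 : E →L[ℂ] E)‖ :=
    le_antisymm (norm_amp_mono w fun x => (norm_inlL_apply x).le)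
      (norm_amp_mono w fun x => (norm_inlL_apply x).ge)
  rw [h3, amp_one, h.norm_eq_one]
  simp

/-- Uses `X X'† - Y Y'† = (X - Y) X'† + Y (X' - Y')†`; the weight `2` is the bound on `Y`. -/
theorem IsPurification.traceNorm_sub_le {ρ Ψ : E →L[ℂ] E}
    {w : lp (fun _ : basisIndex E => E) 2} (h : IsPurification ρ Ψ w)
    {F : Type*} [NormedAddCommGroup F] [InnerProductSpace ℂ F] [CompleteSpace F]
    {X X' Y Y' : E →L[ℂ] F} {α β : ℝ} (hX' : ‖amp w X'‖ ≤ 1) (hY : ‖amp w Y‖ ≤ 2)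
    (hα : ‖amp w (X - Y)‖ ≤ α) (hβ : ‖amp w (X' - Y')‖ ≤ β) :
    traceNorm ((X ∘L Ψ) ∘L adjoint (X' ∘L Ψ) - (Y ∘L Ψ) ∘L adjoint (Y' ∘L Ψ)) ≤
      ENNReal.ofReal (α + 2 * β) := by
  have h1 : (X ∘L Ψ) ∘L adjoint (X' ∘L Ψ) - (Y ∘L Ψ) ∘L adjoint (Y' ∘L Ψ) =
      ((X - Y) ∘L Ψ) ∘L adjoint (X' ∘L Ψ) + (Y ∘L Ψ) ∘L adjoint ((X' - Y') ∘L Ψ) := by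
    rw [sub_comp, sub_comp, sub_comp, map_sub, comp_sub]
    abel
  have hle : ∀ {Z : E →L[ℂ] F} {r : ℝ}, ‖amp w Z‖ ≤ r →
      hsSq (onb E) (Z ∘L Ψ) ≤ ENNReal.ofReal (r ^ 2) := by
    intro Z r hr
    rw [h.hsSq_comp]
    gcongr
  have hα0 := (norm_nonneg _).trans hα
  have hβ0 := (norm_nonneg _).trans hβ
  rw [h1]
  have := traceNorm_le_of_hsSq (onb E) hα0 zero_le_one zero_le_two hβ0 (hle hα) (hle hX')
    (hle hY) (hle hβ)
  rwa [mul_one] at this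

variable {Λ : ℝ}

theorem dataTime_eq (j : Fin N) : dataTime N Λ j = (j : ℕ) * timeStep N Λ := by
  unfold dataTime timeStep
  ring

theorem isPositive_one_sub_meas (R : Realization E (Fin 2)) (a : Fin 2) :
    (1 - R.meas a).IsPositive := by
  have h := R.sum_meas
  rw [Fin.sum_univ_two] at h
  fin_cases a
  · change (1 - R.meas 0).IsPositive
    rw [← h, add_sub_cancel_left]
    exact R.isPositive_meas 1
  · change (1 - R.meas 1).IsPositive
    rw [← h, add_sub_cancel_right]
    exact R.isPositive_meas 0

theorem norm_amp_meas_sq_le_timeline (R : Realization E (Fin 2)) {Ψ : E →L[ℂ] E}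
    {w : lp (fun _ : basisIndex E => E) 2} (hp : IsPurification R.state Ψ w) (a : Fin 2)
    (t : ℝ) : ‖amp w (R.meas a * propagator R.hamiltonian t)‖ ^ 2 ≤ R.timeline a t := by
  unfold Realization.timeline
  rw [hp.evolve_mul R.isSelfAdjoint_hamiltonian (R.isPositive_meas a).isSelfAdjoint,
    hp.trace_comp]
  exact norm_amp_sq_le_re_inner (R.isPositive_meas a) (isPositive_one_sub_meas R a) w _

theorem nearlyCyclic_of_fits (R : Realization E (Fin 2)) {Ψ : E →L[ℂ] E}
    {w : lp (fun _ : basisIndex E => E) 2} (hp : IsPurification R.state Ψ w) (hN : 2 ≤ N)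
    (hΛ : 0 < Λ) {δ : ℝ} (hs : R.HardSupport Λ) (hfit : Fits N Λ δ R.timeline) :
    0 ≤ δ ∧ NearlyCyclic N w (propagator R.hamiltonian (timeStep N Λ)) (R.meas 0) (√(min 1 δ))
      (√(16 * N / Real.sin (Real.pi / N) * √(min 1 δ))) := by
  have hH := R.isSelfAdjoint_hamiltonian
  have hsum := R.sum_meas
  rw [Fin.sum_univ_two] at hsum
  have hU : ∀ t, ‖propagator R.hamiltonian t‖ ≤ 1 := fun t =>
    norm_le_one_of_star_mul_self (star_propagator_mul_self hH t)
  have hM : ∀ a, ‖R.meas a‖ ≤ 1 := fun a =>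
    norm_le_one_of_isPositive (R.isPositive_meas a) (isPositive_one_sub_meas R a)
  have hbound : ∀ (a : Fin 2) (j : Fin N), dataset N a j = 0 →
      ‖amp w (R.meas a * propagator R.hamiltonian ((j : ℕ) * timeStep N Λ))‖ ≤ √(min 1 δ) := by
    intro a j hd
    -- The cap at `1` holds since contractions act on a unit vector; it makes the final estimate
    -- valid for large `δ` too.
    refine Real.le_sqrt_of_sq_le (le_min ?_ ?_)
    · refine pow_le_one₀ (norm_nonneg _) ((hp.norm_amp_le _).trans ((norm_mul_le _ _).trans ?_))
      exact mul_le_one₀ (hM a) (norm_nonneg _) (hU _)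
    · refine (norm_amp_meas_sq_le_timeline R hp a _).trans ?_
      rw [← dataTime_eq]
      have h1 := hfit j
      have h2 := Finset.single_le_sum (s := Finset.univ)
        (f := fun a => |R.timeline a (dataTime N Λ j) - dataset N a j|)
        (fun _ _ => abs_nonneg _) (Finset.mem_univ a)
      simp only [hd, sub_zero] at h2
      exact (le_abs_self _).trans (h2.trans h1)
  have hδ : 0 ≤ δ :=
    (Finset.sum_nonneg fun _ _ => abs_nonneg _).trans (hfit ⟨0, by omega⟩)
  have h1 : ‖amp w (R.meas 1)‖ ≤ √(min 1 δ) := by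
    have := hbound 1 ⟨0, by omega⟩ (by simp [dataset])
    simpa [propagator_zero] using this
  have h0 : ∀ j, 0 < j → j < N →
      ‖amp w (R.meas 0 * propagator R.hamiltonian (j * timeStep N Λ))‖ ≤ √(min 1 δ) :=
    fun j hj hjN => hbound 0 ⟨j, hjN⟩ (by simp [dataset, hj.ne'])
  have hone : 1 - R.meas 0 = R.meas 1 := by rw [← hsum, add_sub_cancel_left]
  refine ⟨hδ, ⟨hN, star_propagator_mul_self hH _, (R.isPositive_meas 0).isSelfAdjoint, hM 0, ?_,
    fun j hj hjN => ?_, ?_⟩⟩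
  · rw [hone]
    exact h1
  · rw [propagator_pow hH]
    exact h0 j hj hjN
  · rw [propagator_pow hH]
    refine Real.le_sqrt_of_sq_le
      (norm_amp_propagator_sub_one_sq_le hH hs hN hΛ w (Real.sqrt_nonneg _) fun j hj hjN => ?_)
    set Uj := propagator R.hamiltonian (j * timeStep N Λ)
    -- In `⟨w, U^j w⟩` the `M₀` part is small at time `t_j`, while in the `M₁` part the operator is
    -- moved onto the left vector, where it is small at time `0`.
    have h2 : amp w Uj = amp w (R.meas 0 * Uj) + amp w (R.meas 1 * Uj) := by
      rw [← map_add, ← add_mul, hsum, one_mul]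
    have h3 : ⟪w, amp w (R.meas 1 * Uj)⟫_ℂ = ⟪amp w (R.meas 1), amp w Uj⟫_ℂ := by
      have h4 : adjoint (R.meas 1) = R.meas 1 := (R.isPositive_meas 1).isSelfAdjoint
      rw [inner_amp_eq, h4]
      rfl
    rw [h2, inner_add_right, h3, two_mul]
    refine (norm_add_le _ _).trans (add_le_add ?_ ?_)
    · refine (norm_inner_le_norm _ _).trans ?_
      rw [hp.norm_eq_one, one_mul]
      exact h0 j hj hjN
    · refine (norm_inner_le_norm _ _).trans ?_
      exact (mul_le_of_le_one_right (norm_nonneg _) ((hp.norm_amp_le _).trans (hU _))).trans h1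

theorem conjIsometry_mul_evolve {F : Type*} [NormedAddCommGroup F] [InnerProductSpace ℂ F]
    [CompleteSpace F] {ρ Ψ H : E →L[ℂ] E} {w : lp (fun _ : basisIndex E => E) 2}
    (hp : IsPurification ρ Ψ w) (hH : IsSelfAdjoint H) (V : E →ₗᵢ[ℂ] F) (M : E →L[ℂ] E) (t : ℝ) :
    conjIsometry V (M * evolve H ρ t) =
      ((V.toContinuousLinearMap ∘L (M * propagator H t)) ∘L Ψ) ∘L
        adjoint ((V.toContinuousLinearMap ∘L propagator H t) ∘L Ψ) := by
  rw [conjIsometry, hp.mul_evolve hH, comp_assoc _ (propagator H t) Ψ,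
    adjoint_comp V.toContinuousLinearMap]
  rfl

theorem norm_exp_energyLevel_le (t : ℝ) (k : Fin N) :
    ‖Complex.exp (-(Complex.I * ((t * energyLevel N Λ k : ℝ) : ℂ)))‖ ≤ 1 := by
  have h1 : -(Complex.I * ((t * energyLevel N Λ k : ℝ) : ℂ)) =
      ((-(t * energyLevel N Λ k) : ℝ) : ℂ) * Complex.I := by
    push_cast
    ring
  rw [h1, Complex.norm_exp_ofReal_mul_I]

theorem NearlyCyclic.norm_amp_dilation_propagator_sub {H M₀ : E →L[ℂ] E} {η ζ : ℝ}
    {w : lp (fun _ : basisIndex E => E) 2}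
    (h : NearlyCyclic N w (propagator H (timeStep N Λ)) M₀ η ζ) (hH : IsSelfAdjoint H)
    (hs : spectrum ℝ H ⊆ Set.Icc 0 Λ) (hΛ : 0 < Λ) (i₀ : Fin N) (t : ℝ) :
    ‖amp w (dilation (measLevel (propagator H (timeStep N Λ)) M₀) i₀ ∘L propagator H t
      - embL (propagator (refHamiltonian N Λ) t (refVector N)))‖ ≤
      N * (|t| * phaseConst N Λ * ζ) + 9 * N ^ 5 * (ζ + η) := by
  rw [propagator_refHamiltonian_refVector]
  exact h.norm_amp_dilation_comp_sub i₀ (norm_exp_energyLevel_le t)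
    fun k => h.norm_amp_propagator_sub hH hs hΛ k t

theorem NearlyCyclic.norm_amp_dilation_meas_propagator_sub {H M₀ : E →L[ℂ] E} {η ζ : ℝ}
    {w : lp (fun _ : basisIndex E => E) 2}
    (h : NearlyCyclic N w (propagator H (timeStep N Λ)) M₀ η ζ) (hH : IsSelfAdjoint H)
    (hs : spectrum ℝ H ⊆ Set.Icc 0 Λ) (hΛ : 0 < Λ) (i₀ : Fin N) (t : ℝ) :
    ‖amp w (dilation (measLevel (propagator H (timeStep N Λ)) M₀) i₀ ∘L (M₀ * propagator H t)
      - embL (refMeas N 0 (propagator (refHamiltonian N Λ) t (refVector N))))‖ ≤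
      N * (|t| * phaseConst N Λ * ζ) + 10 * N ^ 5 * (ζ + η) := by
  rw [refMeas_zero_propagator]
  exact h.norm_amp_dilation_meas_comp_sub i₀ (norm_exp_energyLevel_le t)
    fun k => h.norm_amp_propagator_sub hH hs hΛ k t

theorem comp_one_sub_mul_sub_embL (W : E →L[ℂ] EuclideanSpace ℂ (Fin N) ⊗[ℂ] WithLp 2 (E × E))
    (M S : E →L[ℂ] E) (v v' : EuclideanSpace ℂ (Fin N)) :
    W ∘L ((1 - M) * S) - embL (v - v') =
      (W ∘L S - embL v) - (W ∘L (M * S) - embL v') := by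
  rw [sub_mul, one_mul, comp_sub, embL, tmulL_sub, sub_comp, embL, embL]
  abel

/-- Outcome `1` is the unmeasured estimate minus that for outcome `0`, whence `19 = 9 + 10`. -/
theorem NearlyCyclic.norm_amp_dilation_outcome_sub (R : Realization E (Fin 2))
    {w : lp (fun _ : basisIndex E => E) 2} (hΛ : 0 < Λ) (hs : R.HardSupport Λ) {η ζ : ℝ}
    (h : NearlyCyclic N w (propagator R.hamiltonian (timeStep N Λ)) (R.meas 0) η ζ)
    (i₀ : Fin N) (t : ℝ) (a : Fin 2) :
    ‖amp w (dilation (measLevel (propagator R.hamiltonian (timeStep N Λ)) (R.meas 0)) i₀ ∘L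
        (R.meas a * propagator R.hamiltonian t)
      - embL (refMeas N a (propagator (refHamiltonian N Λ) t (refVector N))))‖ ≤
      2 * (N * (|t| * phaseConst N Λ * ζ)) + 19 * N ^ 5 * (ζ + η) := by
  have hH := R.isSelfAdjoint_hamiltonian
  have hall := h.norm_amp_dilation_propagator_sub hH hs hΛ i₀ t
  have hzero := h.norm_amp_dilation_meas_propagator_sub hH hs hΛ i₀ t
  have hτ : 0 ≤ N * (|t| * phaseConst N Λ * ζ) := mul_nonneg (Nat.cast_nonneg _)
    (mul_nonneg (mul_nonneg (abs_nonneg _) (phaseConst_nonneg h.two_le hΛ)) h.zeta_nonneg)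
  have hε : 0 ≤ (N : ℝ) ^ 5 * (ζ + η) :=
    mul_nonneg (by positivity) (add_nonneg h.zeta_nonneg h.eta_nonneg)
  rcases Fin.exists_fin_two.1 ⟨a, rfl⟩ with rfl | rfl
  · exact hzero.trans (by linarith)
  · have h1 : R.meas 1 = 1 - R.meas 0 := by
      rw [← R.sum_meas, Fin.sum_univ_two, add_sub_cancel_left]
    rw [h1, refMeas_one_apply, comp_one_sub_mul_sub_embL, map_sub]
    refine (norm_sub_le _ _).trans ?_
    linarith

/-- The left factor carries the outcome and the right one only the evolution; the right error has
weight `2`, so `37 = 19 + 2 · 9` and `4 = 2 + 2`. -/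
theorem NearlyCyclic.traceNorm_le (R : Realization E (Fin 2)) {Ψ : E →L[ℂ] E}
    {w : lp (fun _ : basisIndex E => E) 2} (hp : IsPurification R.state Ψ w)
    (hΛ : 0 < Λ) (hs : R.HardSupport Λ) {η ζ : ℝ}
    (h : NearlyCyclic N w (propagator R.hamiltonian (timeStep N Λ)) (R.meas 0) η ζ)
    (i₀ : Fin N) {V : E →ₗᵢ[ℂ] EuclideanSpace ℂ (Fin N) ⊗[ℂ] WithLp 2 (E × E)}
    (hV : V.toContinuousLinearMap =
      dilation (measLevel (propagator R.hamiltonian (timeStep N Λ)) (R.meas 0)) i₀)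
    (t : ℝ) (a : Fin 2) :
    traceNorm (conjIsometry V (R.meas a * evolve R.hamiltonian R.state t) -
      TensorProduct.mapL (refMeas N a * evolve (refHamiltonian N Λ) (proj (refVector N)) t)
        (inlL ∘L R.state ∘L adjoint inlL)) ≤
      ENNReal.ofReal (4 * N * (|t| * phaseConst N Λ * ζ) + 37 * N ^ 5 * (ζ + η)) := by
  have hH := R.isSelfAdjoint_hamiltonian
  have hmeas := h.norm_amp_dilation_outcome_sub R hΛ hs i₀ t a
  have hall := h.norm_amp_dilation_propagator_sub hH hs hΛ i₀ t
  rw [← hV] at hmeas hall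
  rw [conjIsometry_mul_evolve hp hH, mul_evolve_proj (refHamiltonian_isSelfAdjoint N Λ),
    ← hp.mul_self, mapL_rankOne_eq hp.isSelfAdjoint]
  refine (hp.traceNorm_sub_le ?_ ?_ hmeas hall).trans (ENNReal.ofReal_le_ofReal ?_)
  · refine (hp.norm_amp_le _).trans ((opNorm_comp_le _ _).trans ?_)
    exact mul_le_one₀ V.norm_toContinuousLinearMap_le (norm_nonneg _)
      (norm_le_one_of_star_mul_self (star_propagator_mul_self hH t))
  · refine (hp.norm_amp_le _).trans ((norm_embL_le _).trans ?_)
    refine (norm_refMeas_apply_le N h.ne_zero a _).trans ?_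
    rw [norm_propagator_apply (refHamiltonian_isSelfAdjoint N Λ), norm_refVector N h.ne_zero,
      mul_one]
  · linarith

end Estimate

/-- The argument yields the power `1/4` of `min 1 δ`; as the base is at most `1`, smaller exponents
only weaken the bound, and the cap covers `δ > 1`. -/
theorem sqrt_sqrt_min_le_rpow {δ p : ℝ} (hδ : 0 ≤ δ) (hp0 : 0 < p) (hp : p ≤ 1 / 4) :
    √(√(min 1 δ)) ≤ δ ^ p := by
  have hm : 0 ≤ min 1 δ := le_min zero_le_one hδ
  have h1 : √(√(min 1 δ)) = (min 1 δ) ^ (1 / 4 : ℝ) := by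
    rw [Real.sqrt_eq_rpow, Real.sqrt_eq_rpow, ← Real.rpow_mul hm]
    norm_num
  rw [h1]
  exact (Real.rpow_le_rpow_of_exponent_ge_of_imp hm (min_le_left _ _) hp
    fun _ h => absurd h (by norm_num)).trans (Real.rpow_le_rpow hm (min_le_right _ _) hp0.le)

end SelfTest

end

theorem mainTheorem1 (N : ℕ) (hN : 2 ≤ N) (Eplus : ℝ) (hE : 0 < Eplus) :
    ∃ C : ℝ, 0 < C ∧
      ∀ (𝓗 : Type u) [NormedAddCommGroup 𝓗] [InnerProductSpace ℂ 𝓗] [CompleteSpace 𝓗]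
        (R : SelfTest.Realization 𝓗 (Fin 2)) (δ : ℝ),
        R.HardSupport Eplus → SelfTest.Fits N Eplus δ R.timeline →
        ∃ (K : Type u) (_ : NormedAddCommGroup K) (_ : InnerProductSpace ℂ K) (_ : CompleteSpace K)
          (V : 𝓗 →ₗᵢ[ℂ] EuclideanSpace ℂ (Fin N) ⊗[ℂ] K) (γ : K →L[ℂ] K),
          SelfTest.IsDensityOperator γ ∧
          ∀ (t : ℝ) (a : Fin 2),
            SelfTest.traceNorm
              (SelfTest.conjIsometry V
                  (R.meas a * SelfTest.evolve R.hamiltonian R.state t) -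
                TensorProduct.mapL
                  (SelfTest.refMeas N a *
                    SelfTest.evolve (SelfTest.refHamiltonian N Eplus)
                      (SelfTest.proj (SelfTest.refVector N)) t)
                  γ)
              ≤ ENNReal.ofReal (C * δ ^ (1 / 64 : ℝ) + C * (δ ^ (1 / 8 : ℝ) * |t|)) := by
  set c := √(16 * N / Real.sin (Real.pi / N)) with hc
  set κ := SelfTest.phaseConst N Eplus with hκ
  have hκ0 : 0 ≤ κ := SelfTest.phaseConst_nonneg hN hE
  have hc0 : 0 ≤ c := Real.sqrt_nonneg _
  -- With `q = (min 1 δ)^{1/4}` one has `ζ = c q` and `η ≤ q`. The first summand is the coefficient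
  -- of `q` and the second that of `q |t|`.
  refine ⟨37 * N ^ 5 * (c + 1) + 4 * N * (κ * c) + 1, by positivity, ?_⟩
  intro 𝓗 _ _ _ R δ hs hfit
  obtain ⟨Ψ, w, hp⟩ := R.isDensityOperator_state.exists_isPurification
  obtain ⟨hδ, h⟩ := SelfTest.nearlyCyclic_of_fits R hp hN hE hs hfit
  have hi₀ : 0 < N := by omega
  refine ⟨WithLp 2 (𝓗 × 𝓗), inferInstance, inferInstance, inferInstance,
    ⟨(SelfTest.dilation (SelfTest.measLevel (SelfTest.propagator R.hamiltonian
      (SelfTest.timeStep N Eplus)) (R.meas 0)) ⟨0, hi₀⟩).toLinearMap,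
      SelfTest.norm_dilation_apply _ _⟩, _,
    SelfTest.isDensityOperator_inlL hp R.isDensityOperator_state.1, fun t a => ?_⟩
  refine (h.traceNorm_le R hp hE hs ⟨0, hi₀⟩ rfl t a).trans (ENNReal.ofReal_le_ofReal ?_)
  have hs0 := SelfTest.sin_pi_div_pos hN
  set q := √(√(min 1 δ)) with hq
  have hq0 : 0 ≤ q := Real.sqrt_nonneg _
  have hζ : √(16 * N / Real.sin (Real.pi / N) * √(min 1 δ)) = c * q :=
    Real.sqrt_mul (by positivity) _
  have hη : √(min 1 δ) ≤ q := by
    refine Real.le_sqrt_of_sq_le ?_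
    rw [sq]
    exact mul_le_of_le_one_left (Real.sqrt_nonneg _) (Real.sqrt_le_one.2 (min_le_left _ _))
  have h1 : q ≤ δ ^ (1 / 64 : ℝ) :=
    SelfTest.sqrt_sqrt_min_le_rpow hδ (by norm_num) (by norm_num)
  have h2 : q ≤ δ ^ (1 / 8 : ℝ) :=
    SelfTest.sqrt_sqrt_min_le_rpow hδ (by norm_num) (by norm_num)
  rw [hζ]
  set C := 37 * N ^ 5 * (c + 1) + 4 * N * (κ * c) + 1 with hC
  have hC1 : 37 * N ^ 5 * (c + 1) ≤ C := by
    have : 0 ≤ 4 * N * (κ * c) := by positivity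
    linarith
  have hC2 : 4 * N * (κ * c) ≤ C := by
    have : 0 ≤ 37 * N ^ 5 * (c + 1) := by positivity
    linarith
  calc 4 * N * (|t| * κ * (c * q)) + 37 * N ^ 5 * (c * q + √(min 1 δ))
      ≤ 4 * N * (|t| * κ * (c * q)) + 37 * N ^ 5 * (c * q + q) := by gcongr
    _ = 37 * N ^ 5 * (c + 1) * q + 4 * N * (κ * c) * (q * |t|) := by ring
    _ ≤ C * δ ^ (1 / 64 : ℝ) + C * (δ ^ (1 / 8 : ℝ) * |t|) := by gcongr
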